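/- Let $\lambda,\mu>0$ and $\kappa\in\mathbb R$ ($\hbar=1$). A system with Hilbert space $L^2(\mathbb R)$ (position $Q$, momentum $P=-i\,d/dq$) is coupled to two probes with joint Hilbert space $L^2(\mathbb R^2)$ (positions $Q_1,Q_2$, momenta $P_1,P_2$) by the unitary $U=\exp(-iH)$ on $L^2(\mathbb R)\otimes L^2(\mathbb R^2)=L^2(\mathbb R^3)$, where $H$ is the self-adjoint operator determined by $$H=\lambda\,QP_1-\mu\,PQ_2+\tfrac{\lambda\mu}{2}\,\kappa\,P_1Q_2$$ on Schwartz functions. Let $\sigma_{12}$ be an arbitrary density operator (positive operator of trace one) on $L^2(\mathbb R^2)$, the initial state of the probes; it may be pure or mixed, entangled or classically correlated. Let $\mathsf E^{Q_1}$ and $\mathsf E^{P_2}$ be the spectral measures of $Q_1$ and $P_2$, and for a unit vector $\psi\in L^2(\mathbb R)$ let $P_\psi=|\psi\rangle\langle\psi|$. Then there is exactly one normalized positive operator valued measure $\mathsf G=\mathsf G^{(\lambda,\mu)}$ on the Borel sets of $\mathbb R^2$, acting in $L^2(\mathbb R)$, such that for all Borel sets $X,Y\subseteq\mathbb R$ and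 all unit vectors $\psi\in L^2(\mathbb R)$ $$\langle\psi|\mathsf G(X\times Y)\psi\rangle=\operatorname{tr}\big[\,U(P_\psi\otimes\sigma_{12})U^*\,\big(I\otimes\mathsf E^{Q_1}(\lambda X)\otimes\mathsf E^{P_2}(\mu Y)\big)\big],$$ where $\lambda X=\{\lambda x: x\in X\}$ and $\mu Y=\{\mu y:y\in Y\}$. This $\mathsf G$ is a covariant phase space observable: with $W_{qp}=\exp[-i(qP-pQ)]$, $$W_{qp}\,\mathsf G(Z)\,W_{qp}^*=\mathsf G\big(Z+(q,p)\big)\qquad\text{for all }(q,p)\in\mathbb R^2\text{ and all Borel sets }Z\subseteq\mathbb R^2 .$$ -/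

import Mathlib

open MeasureTheory SchwartzMap

noncomputable section

namespace ArthursKelly

/-! ### Hilbert spaces: position representation -/

/-- The Hilbert space `L²(E)` of square-integrable complex functions on a Euclidean space `E`. -/
abbrev L2 (E : Type) [NormedAddCommGroup E] [InnerProductSpace ℝ E] [MeasurableSpace E]
    [BorelSpace E] [FiniteDimensional ℝ E] : Type :=
  Lp ℂ 2 (volume : Measure E)

/-- Configuration space of the two probes, with coordinates `(q₁, q₂)`. -/
abbrev R2 : Type := EuclideanSpace ℝ (Fin 2)

/-- Configuration space of system and probes, with coordinates `(q, q₁, q₂)`. -/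
abbrev R3 : Type := EuclideanSpace ℝ (Fin 3)

section Operators

variable {E : Type} [NormedAddCommGroup E] [InnerProductSpace ℝ E] [MeasurableSpace E]
  [BorelSpace E] [FiniteDimensional ℝ E]

/-! ### Position and momentum -/

/-- The position operator in direction `e` on Schwartz functions, `(Q_e f)(x) = ⟪e, x⟫ f(x)`. -/
def positionOp (e : E) : 𝓢(E, ℂ) →L[ℂ] 𝓢(E, ℂ) :=
  smulLeftCLM ℂ (fun x : E => ((inner ℝ e x : ℝ) : ℂ))

theorem positionOp_apply {E : Type} [NormedAddCommGroup E] [InnerProductSpace ℝ E] (e : E) (f : 𝓢(E, ℂ)) (x : E) :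
    positionOp e f x = ((inner ℝ e x : ℝ) : ℂ) * f x := by
  have h : Function.HasTemperateGrowth (fun x : E => ((inner ℝ e x : ℝ) : ℂ)) :=
    (Complex.ofRealCLM.comp (innerSL ℝ e)).hasTemperateGrowth
  simp [positionOp, smulLeftCLM_apply_apply h]

/-- The momentum operator (`ℏ = 1`) in direction `e` on Schwartz functions, `P_e f = -i ∂_e f`. -/
def momentumOp (e : E) : 𝓢(E, ℂ) →L[ℂ] 𝓢(E, ℂ) :=
  (-Complex.I) • LineDeriv.lineDerivOpCLM ℂ 𝓢(E, ℂ) e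

theorem momentumOp_apply {E : Type} [NormedAddCommGroup E] [InnerProductSpace ℝ E] (e : E) (f : 𝓢(E, ℂ)) (x : E) :
    momentumOp e f x = -Complex.I * lineDeriv ℝ f x e := by
  simp [momentumOp, SchwartzMap.lineDerivOp_apply]

/-- Multiplication by the indicator function of `s`, for measurable `s` (and `0` otherwise). -/
def indicatorOp (s : Set E) : L2 E →L[ℂ] L2 E :=
  open Classical in
  if hs : MeasurableSet s then
    LinearMap.mkContinuous
      { toFun := fun f => ((Lp.memLp f).indicator hs).toLp (s.indicator f)
        map_add' := by
          intro f g
          ext1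
          filter_upwards [((Lp.memLp (f + g)).indicator hs).coeFn_toLp,
            ((Lp.memLp f).indicator hs).coeFn_toLp, ((Lp.memLp g).indicator hs).coeFn_toLp,
            Lp.coeFn_add f g, Lp.coeFn_add (((Lp.memLp f).indicator hs).toLp (s.indicator f))
              (((Lp.memLp g).indicator hs).toLp (s.indicator g))] with x h1 h2 h3 h4 h5
          rw [h1, h5, Pi.add_apply, h2, h3]
          by_cases hx : x ∈ s
          · simpa [hx] using h4
          · simp [hx]
        map_smul' := by
          intro c f
          ext1
          filter_upwards [((Lp.memLp (c • f)).indicator hs).coeFn_toLp,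
            ((Lp.memLp f).indicator hs).coeFn_toLp, Lp.coeFn_smul c f,
            Lp.coeFn_smul c (((Lp.memLp f).indicator hs).toLp (s.indicator f))]
            with x h1 h2 h3 h4
          rw [h1, RingHom.id_apply, h4, Pi.smul_apply, h2]
          by_cases hx : x ∈ s
          · simpa [hx] using h3
          · simp [hx] }
      1 (by
        intro f
        rw [one_mul]
        refine Lp.norm_le_norm_of_ae_le ?_
        filter_upwards [((Lp.memLp f).indicator hs).coeFn_toLp] with x hx
        simp only [LinearMap.coe_mk, AddHom.coe_mk]
        rw [hx]
        exact norm_indicator_le_norm_self _ _)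
  else 0

/-- The spectral measure of position in direction `e`: multiplication by the indicator function
of `{x | ⟪e, x⟫ ∈ X}`. -/
def positionPVM (e : E) (X : Set ℝ) : L2 E →L[ℂ] L2 E :=
  indicatorOp {x : E | inner ℝ e x ∈ X}

/-- The spectral measure of momentum in direction `e`. With Mathlib's Fourier transform
`(𝓕 f)(ξ) = ∫ exp(-2πi⟪x, ξ⟫) f(x) dx`, the operator `P_e = -i ∂_e` becomes multiplication by
`2π⟪e, ξ⟫`. -/
def momentumPVM (e : E) (Y : Set ℝ) : L2 E →L[ℂ] L2 E :=
  ((Lp.fourierTransformₗᵢ E ℂ).symm.toContinuousLinearEquiv : L2 E →L[ℂ] L2 E) ∘L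
    indicatorOp {ξ : E | 2 * Real.pi * inner ℝ e ξ ∈ Y} ∘L
    ((Lp.fourierTransformₗᵢ E ℂ).toContinuousLinearEquiv : L2 E →L[ℂ] L2 E)

/-! ### Unitary exponentials -/

/-- `U = exp(-iA)`, for an operator `A` given on Schwartz space: `U` is the value at `t = 1` of a
strongly continuous one-parameter unitary group `V t = exp(-itA)` whose generator extends
`-iA`. -/
def IsExpNegI (A : 𝓢(E, ℂ) →L[ℂ] 𝓢(E, ℂ)) (U : L2 E →L[ℂ] L2 E) : Prop :=
  ∃ V : ℝ → (L2 E ≃ₗᵢ[ℂ] L2 E),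
    (∀ s t : ℝ, ∀ f : L2 E, V (s + t) f = V s (V t f)) ∧
    (∀ f : L2 E, Continuous fun t => V t f) ∧
    (∀ f : 𝓢(E, ℂ), HasDerivAt (fun t => V t (f.toLp 2 volume)) ((-Complex.I) • (A f).toLp 2 volume) 0) ∧
    ∀ f : L2 E, U f = V 1 f

/-- The operator `exp(-iA)`: the unique `U` with `IsExpNegI A U`. If there is no such operator, or
more than one, the value is `0`, which is not a unitary operator. -/
def expNegI (A : 𝓢(E, ℂ) →L[ℂ] 𝓢(E, ℂ)) : L2 E →L[ℂ] L2 E :=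
  open Classical in
  if h : ∃! U, IsExpNegI A U then h.choose else 0

end Operators

/-! ### Tensor products -/

/-- The splitting `(q, q₁, q₂) ↦ (q, (q₁, q₂))`. -/
def split (x : R3) : ℝ × R2 := (x 0, !₂[x 1, x 2])

theorem measurePreserving_split : MeasurePreserving split (volume : Measure R3) volume := by
  have h1 := EuclideanSpace.volume_preserving_symm_measurableEquiv_toLp (Fin 3)
  have h2 := volume_preserving_piFinSuccAbove (fun _ : Fin 3 => ℝ) 0
  have h3 : MeasurePreserving (Prod.map id (MeasurableEquiv.toLp 2 (Fin 2 → ℝ)))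
      (volume : Measure (ℝ × (Fin 2 → ℝ))) (volume : Measure (ℝ × R2)) :=
    (MeasurePreserving.id volume).prod
      (EuclideanSpace.volume_preserving_symm_measurableEquiv_toLp (Fin 2)).symm
  have h : split = Prod.map id (MeasurableEquiv.toLp 2 (Fin 2 → ℝ)) ∘
      (MeasurableEquiv.piFinSuccAbove (fun _ : Fin 3 => ℝ) 0) ∘
      (MeasurableEquiv.toLp 2 (Fin 3 → ℝ)).symm := by
    funext x
    refine Prod.ext rfl ?_
    ext i
    fin_cases i <;> rfl
  rw [h]
  exact h3.comp (h2.comp h1)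

theorem memLp_tensor (ψ : L2 ℝ) (φ : L2 R2) :
    MemLp (fun x : R3 => ψ (split x).1 * φ (split x).2) 2 volume := by
  have hm : MemLp (fun z : ℝ × R2 => ψ z.1 * φ z.2) 2 volume := by
    have hψ := Lp.memLp ψ
    have hφ := Lp.memLp φ
    have hae : AEStronglyMeasurable (fun z : ℝ × R2 => ψ z.1 * φ z.2) volume :=
      hψ.1.comp_fst.mul hφ.1.comp_snd
    rw [memLp_two_iff_integrable_sq_norm hae]
    rw [memLp_two_iff_integrable_sq_norm hψ.1] at hψ
    rw [memLp_two_iff_integrable_sq_norm hφ.1] at hφ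
    simpa [mul_pow, Measure.volume_eq_prod] using hψ.mul_prod hφ
  exact hm.comp_measurePreserving measurePreserving_split

/-- The vector `ψ ⊗ φ` of `L²(ℝ) ⊗ L²(ℝ²) = L²(ℝ³)`,
`(ψ ⊗ φ)(q, q₁, q₂) = ψ(q) φ(q₁, q₂)`. -/
def tensor (ψ : L2 ℝ) (φ : L2 R2) : L2 R3 := (memLp_tensor ψ φ).toLp

theorem inner_tensor (ψ ψ' : L2 ℝ) (φ φ' : L2 R2) :
    inner ℂ (tensor ψ φ) (tensor ψ' φ') = inner ℂ ψ ψ' * inner ℂ φ φ' := by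
  rw [L2.inner_def, L2.inner_def, L2.inner_def, ← integral_prod_mul]
  have h : ∀ᵐ x : R3, inner ℂ (tensor ψ φ x) (tensor ψ' φ' x) =
      (fun z : ℝ × R2 => inner ℂ (ψ z.1) (ψ' z.1) * inner ℂ (φ z.2) (φ' z.2)) (split x) := by
    filter_upwards [(memLp_tensor ψ φ).coeFn_toLp, (memLp_tensor ψ' φ').coeFn_toLp] with x h1 h2
    rw [tensor, tensor, h1, h2]
    simp
    ring
  rw [integral_congr_ae h, ← integral_map (f := fun z : ℝ × R2 =>
    inner ℂ (ψ z.1) (ψ' z.1) * inner ℂ (φ z.2) (φ' z.2))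
    measurePreserving_split.measurable.aemeasurable, measurePreserving_split.map_eq]
  · rfl
  · rw [measurePreserving_split.map_eq]
    exact (((Lp.aestronglyMeasurable ψ).inner (Lp.aestronglyMeasurable ψ')).comp_fst).mul
      (((Lp.aestronglyMeasurable φ).inner (Lp.aestronglyMeasurable φ')).comp_snd)

theorem norm_tensor (ψ : L2 ℝ) (φ : L2 R2) : ‖tensor ψ φ‖ = ‖ψ‖ * ‖φ‖ := by
  have h := inner_tensor ψ ψ φ φ
  simp only [inner_self_eq_norm_sq_to_K] at h
  have h' : ‖tensor ψ φ‖ ^ 2 = (‖ψ‖ * ‖φ‖) ^ 2 := by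
    rw [mul_pow]
    exact_mod_cast h
  exact (pow_left_inj₀ (norm_nonneg _) (by positivity) two_ne_zero).1 h'

theorem tensor_add (ψ : L2 ℝ) (φ φ' : L2 R2) :
    tensor ψ (φ + φ') = tensor ψ φ + tensor ψ φ' := by
  ext1
  filter_upwards [(memLp_tensor ψ (φ + φ')).coeFn_toLp, (memLp_tensor ψ φ).coeFn_toLp,
    (memLp_tensor ψ φ').coeFn_toLp, Lp.coeFn_add (tensor ψ φ) (tensor ψ φ'),
    (Measure.quasiMeasurePreserving_snd.comp measurePreserving_split.quasiMeasurePreserving).ae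
      (Lp.coeFn_add φ φ')] with x h1 h2 h3 h4 h5
  rw [h4, Pi.add_apply, tensor, tensor, tensor, h1, h2, h3]
  simp only [Function.comp_apply, Pi.add_apply] at h5
  rw [h5, mul_add]

theorem tensor_smul (ψ : L2 ℝ) (c : ℂ) (φ : L2 R2) :
    tensor ψ (c • φ) = c • tensor ψ φ := by
  ext1
  filter_upwards [(memLp_tensor ψ (c • φ)).coeFn_toLp, (memLp_tensor ψ φ).coeFn_toLp,
    Lp.coeFn_smul c (tensor ψ φ),
    (Measure.quasiMeasurePreserving_snd.comp measurePreserving_split.quasiMeasurePreserving).ae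
      (Lp.coeFn_smul c φ)] with x h1 h2 h3 h4
  rw [h3, Pi.smul_apply, tensor, tensor, h1, h2]
  simp only [Function.comp_apply, Pi.smul_apply, smul_eq_mul] at h4 ⊢
  rw [h4]
  ring

/-- The bounded operator `φ ↦ ψ ⊗ φ`. -/
def tensorL (ψ : L2 ℝ) : L2 R2 →L[ℂ] L2 R3 :=
  LinearMap.mkContinuous
    { toFun := tensor ψ
      map_add' := tensor_add ψ
      map_smul' := tensor_smul ψ }
    ‖ψ‖ (fun φ => (norm_tensor ψ φ).le)

/-- The operator `P_ψ ⊗ σ` on `L²(ℝ³)`, where `P_ψ = |ψ⟩⟨ψ|` and `σ` acts on `L²(ℝ²)`. -/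
def pureTensor (ψ : L2 ℝ) (σ : L2 R2 →L[ℂ] L2 R2) : L2 R3 →L[ℂ] L2 R3 :=
  tensorL ψ ∘L σ ∘L ContinuousLinearMap.adjoint (tensorL ψ)

theorem pureTensor_tensor (ψ : L2 ℝ) (σ : L2 R2 →L[ℂ] L2 R2) (f : L2 ℝ) (g : L2 R2) :
    pureTensor ψ σ (tensor f g) = tensor (inner ℂ ψ f • ψ) (σ g) := by
  have h : ContinuousLinearMap.adjoint (tensorL ψ) (tensor f g) = inner ℂ ψ f • g := by
    refine ext_inner_left ℂ fun v => ?_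
    rw [ContinuousLinearMap.adjoint_inner_right, inner_smul_right]
    exact inner_tensor ψ f v g
  have h' : ∀ c : ℂ, tensor (c • ψ) (σ g) = c • tensor ψ (σ g) := by
    intro c
    ext1
    filter_upwards [(memLp_tensor (c • ψ) (σ g)).coeFn_toLp, (memLp_tensor ψ (σ g)).coeFn_toLp,
      Lp.coeFn_smul c (tensor ψ (σ g)),
      (Measure.quasiMeasurePreserving_fst.comp
        measurePreserving_split.quasiMeasurePreserving).ae (Lp.coeFn_smul c ψ)] with x h1 h2 h3 h4
    rw [h3, Pi.smul_apply, tensor, tensor, h1, h2]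
    simp only [Function.comp_apply, Pi.smul_apply, smul_eq_mul] at h4 ⊢
    rw [h4]
    ring
  rw [h', ← tensor_smul, pureTensor, ContinuousLinearMap.comp_apply,
    ContinuousLinearMap.comp_apply, h, map_smul]
  rfl

/-! ### States and observables -/

section Hilbert

variable {H : Type} [NormedAddCommGroup H] [InnerProductSpace ℂ H] [CompleteSpace H]

/-- `T` is trace class with trace `c`: in every orthonormal basis the diagonal matrix elements sum
(unconditionally) to `c`. -/
def HasTrace (T : H →L[ℂ] H) (c : ℂ) : Prop :=
  ∀ (ι : Type) (b : HilbertBasis ι ℂ H), HasSum (fun i => inner ℂ (b i) (T (b i))) c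

/-- A (pure or mixed) state: a positive operator of trace one. -/
def IsDensityOperator (σ : H →L[ℂ] H) : Prop :=
  σ.IsPositive ∧ HasTrace σ 1

end Hilbert

/-- A normalized positive operator valued measure on `Ω`, acting in `H`. It is countably additive
in the weak operator topology; non-measurable sets are assigned the value `0` by convention. -/
structure POVM (Ω : Type) [MeasurableSpace Ω] (H : Type) [NormedAddCommGroup H]
    [InnerProductSpace ℂ H] [CompleteSpace H] where
  /-- The effect that belongs to a set. -/
  effect : Set Ω → (H →L[ℂ] H)
  effect_of_not_measurable : ∀ Z, ¬ MeasurableSet Z → effect Z = 0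
  isPositive : ∀ Z, MeasurableSet Z → (effect Z).IsPositive
  effect_univ : effect Set.univ = 1
  hasSum_iUnion : ∀ Z : ℕ → Set Ω, (∀ n, MeasurableSet (Z n)) →
    Pairwise (Function.onFun Disjoint Z) → ∀ φ ψ : H,
      HasSum (fun n => inner ℂ φ (effect (Z n) ψ)) (inner ℂ φ (effect (⋃ n, Z n) ψ))

/-! ### The model -/

/-- The coordinate directions of system (`0`), first probe (`1`) and second probe (`2`). -/
def dir (i : Fin 3) : R3 := EuclideanSpace.single i 1

/-- The coupling `H = λ Q P₁ - μ P Q₂ + (λμ/2) κ P₁ Q₂`. -/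
def hamiltonian (lam mu κ : ℝ) : 𝓢(R3, ℂ) →L[ℂ] 𝓢(R3, ℂ) :=
  (lam : ℂ) • (positionOp (dir 0) ∘L momentumOp (dir 1))
    - (mu : ℂ) • (momentumOp (dir 0) ∘L positionOp (dir 2))
    + ((lam * mu / 2 * κ : ℝ) : ℂ) • (momentumOp (dir 1) ∘L positionOp (dir 2))

/-- The coupling unitary `U = exp(-iH)`. -/
def coupling (lam mu κ : ℝ) : L2 R3 →L[ℂ] L2 R3 := expNegI (hamiltonian lam mu κ)

/-- The phase space translation `W_{qp} = exp(-i(qP - pQ))` on the system. -/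
def weyl (q p : ℝ) : L2 ℝ →L[ℂ] L2 ℝ :=
  expNegI ((q : ℂ) • momentumOp (1 : ℝ) - (p : ℂ) • positionOp (1 : ℝ))

/-- The pointer projection `I ⊗ E^{Q₁}(X) ⊗ E^{P₂}(Y)`, as the product of the commuting spectral
projections of `Q₁` and `P₂` on `L²(ℝ³)`. -/
def pointer (X Y : Set ℝ) : L2 R3 →L[ℂ] L2 R3 :=
  positionPVM (dir 1) X ∘L momentumPVM (dir 2) Y

/-- `G` is the effective system observable for the probe state `σ`: for every system state
`P_ψ` and all Borel sets `X`, `Y`,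
`tr [U (P_ψ ⊗ σ) U* (I ⊗ E^{Q₁}(λX) ⊗ E^{P₂}(μY))] = ⟨ψ, G(X × Y) ψ⟩`. -/
def IsEffectiveObservable (lam mu κ : ℝ) (σ : L2 R2 →L[ℂ] L2 R2) (G : POVM (ℝ × ℝ) (L2 ℝ)) :
    Prop :=
  ∀ X Y : Set ℝ, MeasurableSet X → MeasurableSet Y → ∀ ψ : L2 ℝ, ‖ψ‖ = 1 →
    HasTrace
      (coupling lam mu κ ∘L pureTensor ψ σ ∘L
        ContinuousLinearMap.adjoint (coupling lam mu κ) ∘L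
        pointer ((fun x => lam * x) '' X) ((fun y => mu * y) '' Y))
      (inner ℂ ψ (G.effect (X ×ˢ Y) ψ))

/-- Covariance under phase space translations: `W_{qp} G(Z) W_{qp}* = G(Z + (q,p))`. -/
def IsCovariant (G : POVM (ℝ × ℝ) (L2 ℝ)) : Prop :=
  ∀ (q p : ℝ) (Z : Set (ℝ × ℝ)), MeasurableSet Z →
    weyl q p ∘L G.effect Z ∘L ContinuousLinearMap.adjoint (weyl q p) =
      G.effect ((fun z => z + (q, p)) '' Z)

end ArthursKelly

end

/-!
The unitaries `exp(-iH)` and `W_{qp}` act on wave functions by measure preserving changes of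
variables and multiplication by phases: the vector field of `H` is linear and nilpotent, so its flow
is explicit, and uniqueness of the Schrödinger evolution identifies the unitary group with this
flow. Writing `σ = S²`, the outcome probabilities become `∑ᵢ ⟪Kᵢ ψ, P(X × Y) Kᵢ ψ⟫` with the Kraus
operators `Kᵢ ψ = U (ψ ⊗ S bᵢ)` and the joint spectral measure `P` of the commuting pointers `Q₁`
and `P₂`; this defines `G(Z) = ∑ᵢ Kᵢ* P(Z) Kᵢ`. Since `U` turns a phase space translation of the
system into one of the pointers, `Kᵢ W_{qp}* = D Kᵢ` with a displacement `D` which shifts `P` by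
`(q, p)`, and `G` is covariant.
-/

open Filter Topology FourierTransform

noncomputable section

namespace ArthursKelly

/-! ### Weighted composition operators -/

/-- A measure-preserving map together with a unimodular weight, the data of the isometry
`f ↦ phase · (f ∘ map)` of `Lᵖ`. -/
@[ext]
structure PhaseMap {α : Type*} [MeasurableSpace α] (μ : Measure α) where
  /-- The unimodular weight. -/
  phase : α → ℂ
  /-- The transformation of the underlying space. -/
  map : α → α
  measurable_phase : Measurable phase
  norm_phase : ∀ x, ‖phase x‖ = 1
  measurePreserving : MeasurePreserving map μ μ

namespace PhaseMap

variable {α : Type*} [MeasurableSpace α] {μ : Measure α} {p : ENNReal}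

/-- The product of two weighted composition operators: first `d`, then `c`. -/
def comp (c d : PhaseMap μ) : PhaseMap μ where
  phase x := c.phase x * d.phase (c.map x)
  map := d.map ∘ c.map
  measurable_phase :=
    c.measurable_phase.mul (d.measurable_phase.comp c.measurePreserving.measurable)
  norm_phase x := by rw [norm_mul, c.norm_phase, d.norm_phase, one_mul]
  measurePreserving := d.measurePreserving.comp c.measurePreserving

theorem memLp (c : PhaseMap μ) {f : α → ℂ} (hf : MemLp f p μ) :
    MemLp (fun x => c.phase x * f (c.map x)) p μ := by
  have h := hf.comp_measurePreserving c.measurePreserving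
  refine h.of_le (c.measurable_phase.aestronglyMeasurable.mul h.1)
    (Eventually.of_forall fun x => ?_)
  simp [c.norm_phase]

theorem eLpNorm_eq (c : PhaseMap μ) {f : α → ℂ} (hf : AEStronglyMeasurable f μ) :
    eLpNorm (fun x => c.phase x * f (c.map x)) p μ = eLpNorm f p μ := by
  rw [← eLpNorm_comp_measurePreserving hf c.measurePreserving]
  refine eLpNorm_congr_norm_ae (Eventually.of_forall fun x => ?_)
  simp [c.norm_phase]

theorem ae_comp (c : PhaseMap μ) {P : α → Prop} (h : ∀ᵐ x ∂μ, P x) : ∀ᵐ x ∂μ, P (c.map x) :=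
  c.measurePreserving.quasiMeasurePreserving.ae h

variable [Fact (1 ≤ p)]

/-- The isometry `f ↦ phase · (f ∘ map)` of `Lᵖ`. -/
def op (c : PhaseMap μ) : Lp ℂ p μ →ₗᵢ[ℂ] Lp ℂ p μ where
  toFun f := (c.memLp (Lp.memLp f)).toLp
  map_add' f g := by
    ext1
    filter_upwards [(c.memLp (Lp.memLp (f + g))).coeFn_toLp, (c.memLp (Lp.memLp f)).coeFn_toLp,
      (c.memLp (Lp.memLp g)).coeFn_toLp, c.ae_comp (Lp.coeFn_add f g),
      Lp.coeFn_add (c.memLp (Lp.memLp f)).toLp (c.memLp (Lp.memLp g)).toLp] with x h1 h2 h3 h4 h5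
    rw [h1, h5, Pi.add_apply, h2, h3, h4, Pi.add_apply, mul_add]
  map_smul' k f := by
    ext1
    filter_upwards [(c.memLp (Lp.memLp (k • f))).coeFn_toLp, (c.memLp (Lp.memLp f)).coeFn_toLp,
      Lp.coeFn_smul k (c.memLp (Lp.memLp f)).toLp, c.ae_comp (Lp.coeFn_smul k f)] with x h1 h2 h3 h4
    rw [h1, RingHom.id_apply, h3, Pi.smul_apply, h2, h4, Pi.smul_apply, smul_eq_mul, smul_eq_mul,
      mul_left_comm]
  norm_map' f := by
    change ‖(c.memLp (Lp.memLp f)).toLp‖ = ‖f‖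
    rw [Lp.norm_toLp, c.eLpNorm_eq (Lp.memLp f).1, Lp.norm_def]

theorem coeFn_op (c : PhaseMap μ) (f : Lp ℂ p μ) :
    c.op f =ᵐ[μ] fun x => c.phase x * f (c.map x) :=
  (c.memLp (Lp.memLp f)).coeFn_toLp

theorem op_toLp (c : PhaseMap μ) {f : α → ℂ} (hf : MemLp f p μ) :
    c.op hf.toLp = (c.memLp hf).toLp := by
  ext1
  filter_upwards [c.coeFn_op hf.toLp, (c.memLp hf).coeFn_toLp, c.ae_comp hf.coeFn_toLp]
    with x h1 h2 h3
  rw [h1, h2, h3]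

theorem op_comp (c d : PhaseMap μ) (f : Lp ℂ p μ) : (c.comp d).op f = c.op (d.op f) := by
  ext1
  filter_upwards [(c.comp d).coeFn_op f, c.coeFn_op (d.op f), c.ae_comp (d.coeFn_op f)]
    with x h1 h2 h3
  rw [h1, h2, h3, ← mul_assoc]
  rfl

end PhaseMap

section Indicator

variable {E : Type} [NormedAddCommGroup E] [InnerProductSpace ℝ E] [MeasurableSpace E]
  [BorelSpace E] [FiniteDimensional ℝ E]

theorem coeFn_indicatorOp {s : Set E} (hs : MeasurableSet s) (f : L2 E) :
    indicatorOp s f =ᵐ[volume] s.indicator f := by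
  rw [indicatorOp, dif_pos hs]
  exact ((Lp.memLp f).indicator hs).coeFn_toLp

theorem PhaseMap.indicatorOp_preimage_op (c : PhaseMap (volume : Measure E)) {s : Set E}
    (hs : MeasurableSet s) (f : L2 E) :
    indicatorOp (c.map ⁻¹' s) (c.op f) = c.op (indicatorOp s f) := by
  ext1
  filter_upwards [coeFn_indicatorOp (c.measurePreserving.measurable hs) (c.op f), c.coeFn_op f,
    c.coeFn_op (indicatorOp s f), c.ae_comp (coeFn_indicatorOp hs f)] with x h1 h2 h3 h4
  rw [h1, h3, h4]
  by_cases hx : c.map x ∈ s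
  · rw [Set.indicator_of_mem (Set.mem_preimage.2 hx), Set.indicator_of_mem hx, h2]
  · rw [Set.indicator_of_notMem (by simpa using hx), Set.indicator_of_notMem hx, mul_zero]

end Indicator

/-! ### Differentiation in `Lᵖ` -/

section Dominated

variable {α ι G : Type*} [MeasurableSpace α] {μ : Measure α} {p : ENNReal} [Fact (1 ≤ p)]
  [NormedAddCommGroup G]

theorem tendsto_toLp_of_dominated (hp : p ≠ ⊤) {l : Filter ι} [l.IsCountablyGenerated]
    {F : ι → α → G} {f : α → G} {bound : α → ℝ} (hF : ∀ i, MemLp (F i) p μ) (hf : MemLp f p μ)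
    (hbound : MemLp bound p μ) (hle : ∀ᶠ i in l, ∀ᵐ x ∂μ, ‖F i x‖ ≤ bound x)
    (hlim : ∀ᵐ x ∂μ, Tendsto (fun i => F i x) l (𝓝 (f x))) :
    Tendsto (fun i => (hF i).toLp) l (𝓝 hf.toLp) := by
  have hp0 : p ≠ 0 := (zero_lt_one.trans_le (Fact.out : 1 ≤ p)).ne'
  have hpos : 0 < p.toReal := ENNReal.toReal_pos hp0 hp
  rw [Lp.tendsto_Lp_iff_tendsto_eLpNorm'' _ hF _ hf]
  simp only [eLpNorm_eq_lintegral_rpow_enorm_toReal hp0 hp]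
  have hzero : (0 : ENNReal) = (∫⁻ _ : α, 0 ∂μ) ^ (1 / p.toReal) := by simp [hpos]
  rw [hzero]
  refine (ENNReal.continuous_rpow_const.tendsto _).comp ?_
  refine tendsto_lintegral_filter_of_dominated_convergence'
    (fun x => ‖bound x + ‖f x‖‖ₑ ^ p.toReal) ?_ ?_ ?_ ?_
  · exact Eventually.of_forall fun i => ((hF i).sub hf).1.enorm.pow_const _
  · filter_upwards [hle] with i hi
    filter_upwards [hi] with x hx
    gcongr
    rw [enorm_le_iff_norm_le, Real.norm_eq_abs, Pi.sub_apply]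
    exact (norm_sub_le _ _).trans ((add_le_add_left hx _).trans (le_abs_self _))
  · exact (lintegral_rpow_enorm_lt_top_of_eLpNorm_lt_top hp0 hp (hbound.add hf.norm).2).ne
  · filter_upwards [hlim] with x hx
    have h : Tendsto (fun i => ‖F i x - f x‖ₑ) l (𝓝 0) := by
      simpa using (hx.sub_const (f x)).enorm
    simpa [hpos, Function.comp_def] using
      (ENNReal.continuous_rpow_const (y := p.toReal)).continuousAt.tendsto.comp h

theorem hasDerivAt_toLp_of_dominated [NormedSpace ℝ G] (hp : p ≠ ⊤) {F : ℝ → α → G} {F' : α → G}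
    {bound : α → ℝ} {t₀ : ℝ} (hF : ∀ t, MemLp (F t) p μ) (hF' : MemLp F' p μ)
    (hbound : MemLp bound p μ) (hderiv : ∀ᵐ x ∂μ, HasDerivAt (fun t => F t x) (F' x) t₀)
    (hle : ∀ᶠ t in 𝓝 t₀, ∀ᵐ x ∂μ, ‖F t x - F t₀ x‖ ≤ bound x * |t - t₀|) :
    HasDerivAt (fun t => (hF t).toLp) hF'.toLp t₀ := by
  have hslope (t : ℝ) : MemLp (fun x => slope (fun t => F t x) t₀ t) p μ :=
    ((hF t).sub (hF t₀)).const_smul (t - t₀)⁻¹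
  have heq : slope (fun t => (hF t).toLp) t₀ = fun t => (hslope t).toLp := by
    funext t
    rw [slope_def_module, ← MemLp.toLp_sub, ← MemLp.toLp_const_smul]
    rfl
  rw [hasDerivAt_iff_tendsto_slope, heq]
  refine tendsto_toLp_of_dominated hp hslope hF' hbound ?_ ?_
  · filter_upwards [nhdsWithin_le_nhds hle, self_mem_nhdsWithin] with t ht hne
    filter_upwards [ht] with x hx
    rwa [slope_def_module, norm_smul, norm_inv, Real.norm_eq_abs,
      inv_mul_le_iff₀ (abs_pos.2 (sub_ne_zero.2 hne)), mul_comm |t - t₀|]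
  · filter_upwards [hderiv] with x hx
    exact hasDerivAt_iff_tendsto_slope.1 hx

end Dominated

/-! ### One-parameter groups of isometries -/

section IsometryGroup

variable {𝕜 H : Type*} [NormedField 𝕜] [NormedAddCommGroup H] [NormedSpace 𝕜 H]
  {V W : ℝ → (H ≃ₗᵢ[𝕜] H)} {D : Set H}

theorem isometryGroup_zero (hV : ∀ s t f, V (s + t) f = V s (V t f)) (f : H) : V 0 f = f :=
  (V 0).injective (by rw [← hV, add_zero])

theorem continuous_isometryGroup (hV : ∀ s t f, V (s + t) f = V s (V t f)) (hD : Dense D)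
    (hcont : ∀ f ∈ D, ContinuousAt (fun t => V t f) 0) (f : H) : Continuous fun t => V t f := by
  have hzero : Tendsto (fun t => V t f) (𝓝 0) (𝓝 f) := by
    have hequi : Equicontinuous fun t => (V t : H → H) :=
      (LipschitzWith.uniformEquicontinuous _ 1 fun t => (V t).lipschitz).equicontinuous
    have hmem : closure D ⊆ {f | Tendsto (fun t => V t f) (𝓝 0) (𝓝 f)} :=
      (hequi.isClosed_setOfPred_tendsto continuous_id).closure_subset_iff.2 fun g hg => by
        simpa [ContinuousAt, isometryGroup_zero hV] using hcont g hg
    exact hmem (hD f)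
  refine continuous_iff_continuousAt.2 fun t => ?_
  have hshift : (fun s => V s f) = fun s => V t (V (s - t) f) := by
    funext s
    rw [← hV, add_sub_cancel]
  rw [hshift]
  have hsub : Tendsto (fun s => s - t) (𝓝 t) (𝓝 0) := tendsto_sub_nhds_zero_iff.2 tendsto_id
  simpa [ContinuousAt, isometryGroup_zero hV, Function.comp_def] using
    ((V t).continuous.tendsto f).comp (hzero.comp hsub)

theorem isometryGroup_eqOn [NormedSpace ℝ H] (hV : ∀ s t f, V (s + t) f = V s (V t f))
    (hW : ∀ s t f, W (s + t) f = W s (W t f)) (hmaps : ∀ t, Set.MapsTo (V t) D D)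
    (hderiv : ∀ f ∈ D, HasDerivAt (fun t => V t f - W t f) 0 0) (t : ℝ) :
    Set.EqOn (V t) (W t) D := by
  intro f hf
  set u : ℝ → H := fun s => W (t - s) (V s f) with hu
  have hu' (s : ℝ) : HasDerivAt u 0 s := by
    have hnorm (r : ℝ) : ‖u r - u s‖ = ‖V (r - s) (V s f) - W (r - s) (V s f)‖ := by
      have hus : u s = W (t - r) (W (r - s) (V s f)) := by rw [← hW, sub_add_sub_cancel]
      rw [hus, ← map_sub, (W (t - r)).norm_map, ← hV, sub_add_cancel]
    have hsub : Tendsto (fun r => r - s) (𝓝 s) (𝓝 0) := tendsto_sub_nhds_zero_iff.2 tendsto_id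
    have hg := (hasDerivAt_iff_isLittleO.1 (hderiv _ (hmaps s hf))).comp_tendsto hsub
    rw [hasDerivAt_iff_isLittleO, ← Asymptotics.isLittleO_norm_left]
    simpa [hnorm, Function.comp_def, isometryGroup_zero hV, isometryGroup_zero hW]
      using hg.norm_left
  have hconst : u t = u 0 :=
    is_const_of_deriv_eq_zero (fun s => (hu' s).differentiableAt) (fun s => (hu' s).deriv) t 0
  simpa [hu, isometryGroup_zero hV, isometryGroup_zero hW] using hconst

end IsometryGroup

/-! ### Unitary exponentials -/

theorem exists_norm_le_inv_one_add_norm_pow {E G : Type*} [NormedAddCommGroup E] [NormedSpace ℝ E]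
    [NormedAddCommGroup G] [NormedSpace ℝ G] (g : 𝓢(E, G)) (n : ℕ) :
    ∃ C : ℝ, ∀ x, ‖g x‖ ≤ C * ((1 + ‖x‖) ^ n)⁻¹ := by
  obtain ⟨C, hC⟩ : ∃ C : ℝ, ∀ x, (1 + ‖x‖) ^ n * ‖g x‖ ≤ C :=
    ⟨_, fun x => by
      simpa only [norm_iteratedFDeriv_zero] using SchwartzMap.one_add_le_sup_seminorm_apply (𝕜 := ℝ)
        (m := (n, 0)) (n := 0) le_rfl le_rfl g x⟩
  refine ⟨C, fun x => ?_⟩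
  rw [← div_eq_mul_inv, le_div_iff₀ (by positivity), mul_comm]
  exact hC x

section Exponential

variable {E : Type} [NormedAddCommGroup E] [InnerProductSpace ℝ E] [MeasurableSpace E]
  [BorelSpace E] [FiniteDimensional ℝ E]

theorem denseRange_schwartz_toLp : DenseRange fun f : 𝓢(E, ℂ) => (f.toLp 2 volume : L2 E) :=
  SchwartzMap.denseRange_toLpCLM (F := ℂ) (p := 2) (μ := (volume : Measure E))
    ENNReal.ofNat_ne_top

theorem expNegI_eq {A : 𝓢(E, ℂ) →L[ℂ] 𝓢(E, ℂ)} {V : ℝ → (L2 E ≃ₗᵢ[ℂ] L2 E)}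
    (hV : ∀ s t f, V (s + t) f = V s (V t f))
    (hA : ∀ f : 𝓢(E, ℂ), HasDerivAt (fun t => V t (f.toLp 2 volume))
      ((-Complex.I) • (A f).toLp 2 volume) 0)
    (hS : ∀ t, Set.MapsTo (V t) (Set.range fun f : 𝓢(E, ℂ) => f.toLp 2 volume)
      (Set.range fun f : 𝓢(E, ℂ) => f.toLp 2 volume))
    (f : L2 E) : expNegI A f = V 1 f := by
  have hcont : ∀ f, Continuous fun t => V t f :=
    continuous_isometryGroup hV denseRange_schwartz_toLp
      (Set.forall_mem_range.2 fun f => (hA f).continuousAt)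
  have hex : IsExpNegI A ((V 1).toContinuousLinearEquiv : L2 E →L[ℂ] L2 E) :=
    ⟨V, hV, hcont, hA, fun _ => rfl⟩
  have huniq : ∀ U, IsExpNegI A U → U = ((V 1).toContinuousLinearEquiv : L2 E →L[ℂ] L2 E) := by
    rintro U ⟨W, hW, -, hW', hU⟩
    have heq := isometryGroup_eqOn hV hW hS
      (Set.forall_mem_range.2 fun f =>
        ((hA f).sub (hW' f)).congr_deriv (sub_self _)) 1
    ext1 f
    rw [hU]
    exact (congrFun ((V 1).continuous.ext_on denseRange_schwartz_toLp (W 1).continuous heq) f).symm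
  have h : ∃! U, IsExpNegI A U := ⟨_, hex, huniq⟩
  rw [expNegI, dif_pos h, huniq _ h.choose_spec.1]
  rfl

theorem memLp_two_inv_one_add_norm_pow {n : ℕ} (hn : Module.finrank ℝ E < n) :
    MemLp (fun x : E => ((1 + ‖x‖) ^ n)⁻¹) 2 volume := by
  have hmeas : AEStronglyMeasurable (fun x : E => ((1 + ‖x‖) ^ n)⁻¹) volume :=
    (Continuous.inv₀ (by fun_prop) fun x => by positivity).aestronglyMeasurable
  have hint : Integrable (fun x : E => (1 + ‖x‖) ^ (-(n : ℝ))) volume :=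
    integrable_one_add_norm (by exact_mod_cast hn)
  rw [memLp_two_iff_integrable_sq_norm hmeas]
  refine hint.mono' (hmeas.norm.pow 2) (Eventually.of_forall fun x => ?_)
  have h1 : (1 : ℝ) ≤ (1 + ‖x‖) ^ n := one_le_pow₀ (by linarith [norm_nonneg x])
  rw [Real.rpow_neg (by positivity), Real.rpow_natCast, norm_pow, norm_norm, norm_inv,
    Real.norm_of_nonneg (by positivity), sq]
  exact mul_le_of_le_one_left (by positivity) (inv_le_one_of_one_le₀ h1)

/-- A one-parameter group of weighted composition operators that acts on Schwartz functions and
moves points in a controlled way; it integrates a first order differential operator. -/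
structure PhaseFlow (E : Type) [NormedAddCommGroup E] [InnerProductSpace ℝ E] [MeasurableSpace E]
    [BorelSpace E] [FiniteDimensional ℝ E] where
  /-- The weighted composition at a given time. -/
  phaseMap : ℝ → PhaseMap (volume : Measure E)
  phaseMap_add : ∀ s t, phaseMap (s + t) = (phaseMap s).comp (phaseMap t)
  /-- The action on Schwartz functions. -/
  onSchwartz : ℝ → 𝓢(E, ℂ) → 𝓢(E, ℂ)
  onSchwartz_apply : ∀ t f x, onSchwartz t f x = (phaseMap t).phase x * f ((phaseMap t).map x)
  exists_le : ∃ K : ℝ, ∀ t : ℝ, |t| ≤ 1 → ∀ x, 1 + ‖x‖ ≤ K * (1 + ‖(phaseMap t).map x‖)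

namespace PhaseFlow

variable (F : PhaseFlow E)

theorem op_add (s t : ℝ) (f : L2 E) :
    (F.phaseMap (s + t)).op f = (F.phaseMap s).op ((F.phaseMap t).op f) := by
  rw [F.phaseMap_add, PhaseMap.op_comp]

theorem op_zero (f : L2 E) : (F.phaseMap 0).op f = f :=
  (F.phaseMap 0).op.injective (by rw [← op_add, add_zero])

/-- The unitary group of a flow. -/
def unitary (t : ℝ) : L2 E ≃ₗᵢ[ℂ] L2 E where
  toLinearEquiv := LinearEquiv.ofLinearMap (F.phaseMap t).op.toLinearMap
    (F.phaseMap (-t)).op.toLinearMap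
    (LinearMap.ext fun f => by
      change (F.phaseMap t).op ((F.phaseMap (-t)).op f) = f
      rw [← op_add, add_neg_cancel, op_zero])
    (LinearMap.ext fun f => by
      change (F.phaseMap (-t)).op ((F.phaseMap t).op f) = f
      rw [← op_add, neg_add_cancel, op_zero])
  norm_map' := (F.phaseMap t).op.norm_map

theorem unitary_schwartz (t : ℝ) (f : 𝓢(E, ℂ)) :
    F.unitary t (f.toLp 2 volume) = (F.onSchwartz t f).toLp 2 volume := by
  refine ((F.phaseMap t).op_toLp (f.memLp 2 volume)).trans (MemLp.toLp_congr _ _ ?_)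
  exact Eventually.of_forall fun x => (F.onSchwartz_apply t f x).symm

theorem exists_norm_le (g : 𝓢(E, ℂ)) : ∃ bound : E → ℝ, MemLp bound 2 (volume : Measure E) ∧
    ∀ t : ℝ, |t| ≤ 1 → ∀ x, ‖g ((F.phaseMap t).map x)‖ ≤ bound x := by
  obtain ⟨K, hK⟩ := F.exists_le
  set n : ℕ := Module.finrank ℝ E + 1
  obtain ⟨C, hC⟩ := exists_norm_le_inv_one_add_norm_pow g n
  have hC0 : 0 ≤ C := by simpa using (norm_nonneg (g 0)).trans (hC 0)
  refine ⟨fun x => C * K ^ n * ((1 + ‖x‖) ^ n)⁻¹,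
    (memLp_two_inv_one_add_norm_pow (Nat.lt_succ_self _)).const_mul _, fun t ht x => ?_⟩
  have hpow : (1 + ‖x‖) ^ n ≤ K ^ n * (1 + ‖(F.phaseMap t).map x‖) ^ n := by
    rw [← mul_pow]
    exact pow_le_pow_left₀ (by positivity) (hK t ht x) n
  calc ‖g ((F.phaseMap t).map x)‖ ≤ C * ((1 + ‖(F.phaseMap t).map x‖) ^ n)⁻¹ := hC _
    _ ≤ C * (K ^ n * ((1 + ‖x‖) ^ n)⁻¹) := by
        gcongr
        rwa [← div_eq_mul_inv, le_div_iff₀ (by positivity), inv_mul_le_iff₀ (by positivity),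
          mul_comm]
    _ = C * K ^ n * ((1 + ‖x‖) ^ n)⁻¹ := by ring

variable {A : 𝓢(E, ℂ) →L[ℂ] 𝓢(E, ℂ)}

theorem hasDerivAt_onSchwartz {f : 𝓢(E, ℂ)}
    (hA : ∀ x, HasDerivAt (fun t => F.onSchwartz t f x) (-Complex.I * A f x) 0) (s : ℝ) (x : E) :
    HasDerivAt (fun t => F.onSchwartz t f x)
      ((F.phaseMap s).phase x * (-Complex.I * A f ((F.phaseMap s).map x))) s := by
  have hshift (t : ℝ) : F.onSchwartz t f x =
      (F.phaseMap s).phase x * F.onSchwartz (t - s) f ((F.phaseMap s).map x) := by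
    obtain ⟨r, rfl⟩ : ∃ r, t = s + r := ⟨t - s, by ring⟩
    simp only [F.onSchwartz_apply, F.phaseMap_add, add_sub_cancel_left, ← mul_assoc]
    rfl
  have h := hA ((F.phaseMap s).map x)
  rw [← sub_self s] at h
  exact ((h.comp_sub_const s s).const_mul _).congr_of_eventuallyEq (Eventually.of_forall hshift)

theorem hasDerivAt_unitary {f : 𝓢(E, ℂ)}
    (hA : ∀ x, HasDerivAt (fun t => F.onSchwartz t f x) (-Complex.I * A f x) 0) :
    HasDerivAt (fun t => F.unitary t (f.toLp 2 volume)) ((-Complex.I) • (A f).toLp 2 volume) 0 := by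
  obtain ⟨bound, hbound, hle⟩ := F.exists_norm_le (A f)
  have hLip (t : ℝ) (ht : |t| ≤ 1) (x : E) :
      ‖F.onSchwartz t f x - F.onSchwartz 0 f x‖ ≤ bound x * |t - 0| := by
    refine (convex_uIcc 0 t).norm_image_sub_le_of_norm_hasDerivWithin_le
      (fun s _ => (F.hasDerivAt_onSchwartz hA s x).hasDerivWithinAt) (fun s hs => ?_)
      Set.left_mem_uIcc Set.right_mem_uIcc
    have hs1 : |s| ≤ 1 := by simpa using (Set.abs_sub_left_of_mem_uIcc hs).trans (by simpa using ht)
    simpa [(F.phaseMap s).norm_phase] using hle s hs1 x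
  simp only [unitary_schwartz]
  refine hasDerivAt_toLp_of_dominated ENNReal.ofNat_ne_top
    (fun t => (F.onSchwartz t f).memLp 2 volume) (((-Complex.I) • A f).memLp 2 volume) hbound
    (Eventually.of_forall hA) ?_
  filter_upwards [Metric.closedBall_mem_nhds (0 : ℝ) one_pos] with t ht
  exact Eventually.of_forall (hLip t (by simpa using ht))

theorem expNegI_eq_op
    (hA : ∀ f x, HasDerivAt (fun t => F.onSchwartz t f x) (-Complex.I * A f x) 0) (f : L2 E) :
    expNegI A f = (F.phaseMap 1).op f := by
  refine expNegI_eq (V := F.unitary) F.op_add (fun f => F.hasDerivAt_unitary (hA f)) ?_ f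
  rintro t _ ⟨f, rfl⟩
  exact ⟨F.onSchwartz t f, (F.unitary_schwartz t f).symm⟩

end PhaseFlow

end Exponential

/-! ### Displacements -/

theorem iteratedDeriv_cexp_I_mul_ofReal (n : ℕ) :
    iteratedDeriv n (fun x : ℝ => Complex.exp (Complex.I * x)) =
      fun x : ℝ => Complex.I ^ n * Complex.exp (Complex.I * x) := by
  induction n with
  | zero => simp
  | succ n ih =>
    funext x
    have h : HasDerivAt (fun x : ℝ => Complex.exp (Complex.I * x))
        (Complex.exp (Complex.I * x) * (Complex.I * 1)) x :=
      ((hasDerivAt_id x).ofReal_comp.const_mul Complex.I).cexp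
    rw [iteratedDeriv_succ, ih, (h.const_mul _).deriv]
    ring

theorem hasTemperateGrowth_cexp_I_mul_ofReal :
    Function.HasTemperateGrowth fun x : ℝ => Complex.exp (Complex.I * x) := by
  refine ⟨(contDiff_const.mul Complex.ofRealCLM.contDiff).cexp, fun n => ⟨0, 1, fun x => ?_⟩⟩
  rw [norm_iteratedFDeriv_eq_norm_iteratedDeriv, iteratedDeriv_cexp_I_mul_ofReal, norm_mul,
    mul_comm Complex.I, Complex.norm_exp_ofReal_mul_I]
  simp

theorem hasTemperateGrowth_cexp_I_mul_inner {E : Type*} [NormedAddCommGroup E]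
    [InnerProductSpace ℝ E] (w : E) (θ : ℝ) :
    Function.HasTemperateGrowth
      fun x : E => Complex.exp (Complex.I * ((inner ℝ w x + θ : ℝ) : ℂ)) :=
  hasTemperateGrowth_cexp_I_mul_ofReal.comp
    ((innerSL ℝ w).hasTemperateGrowth.add (Function.HasTemperateGrowth.const θ))

section Displacement

variable {E : Type} [NormedAddCommGroup E] [InnerProductSpace ℝ E] [MeasurableSpace E]
  [BorelSpace E] [FiniteDimensional ℝ E]

/-- The phase space displacement `f ↦ exp(i(⟪w, x⟫ + θ)) f(x + v)`: a translation, a boost and a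
global phase. -/
def displacement (θ : ℝ) (v w : E) : PhaseMap (volume : Measure E) where
  phase x := Complex.exp (Complex.I * ((inner ℝ w x + θ : ℝ) : ℂ))
  map x := x + v
  measurable_phase := (hasTemperateGrowth_cexp_I_mul_inner w θ).1.continuous.measurable
  norm_phase x := by rw [mul_comm, Complex.norm_exp_ofReal_mul_I]
  measurePreserving := measurePreserving_add_right volume v

theorem displacement_comp (θ θ' : ℝ) (v v' w w' : E) :
    (displacement θ v w).comp (displacement θ' v' w') =
      displacement (θ + θ' + inner ℝ w' v) (v + v') (w + w') := by
  ext x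
  · simp only [PhaseMap.comp, displacement, ← Complex.exp_add, inner_add_left, inner_add_right]
    congr 1
    push_cast
    ring
  · simp only [PhaseMap.comp, displacement, Function.comp_apply, add_assoc]

theorem displacement_zero_op (f : L2 E) : (displacement 0 0 (0 : E)).op f = f := by
  ext1
  filter_upwards [(displacement 0 0 (0 : E)).coeFn_op f] with x hx
  rw [hx]
  simp [displacement]

theorem displacement_op_neg (θ : ℝ) (v w : E) (f : L2 E) :
    (displacement θ v w).op ((displacement (inner ℝ w v - θ) (-v) (-w)).op f) = f := by
  rw [← PhaseMap.op_comp, displacement_comp, inner_neg_left]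
  convert displacement_zero_op f using 4 <;> abel

/-- The group `exp(-it(P_v - Q_w))`. -/
def displacementFlow (v w : E) : PhaseFlow E where
  phaseMap t := displacement (-(t ^ 2 * inner ℝ w v) / 2) (-(t • v)) (t • w)
  phaseMap_add s t := by
    rw [displacement_comp, inner_neg_right, real_inner_smul_left, real_inner_smul_right]
    congr 1
    · ring
    · module
    · module
  onSchwartz t f :=
    smulLeftCLM ℂ (displacement (-(t ^ 2 * inner ℝ w v) / 2) (-(t • v)) (t • w)).phase
      (compSubConstCLM ℂ (t • v) f)
  onSchwartz_apply t f x := by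
    refine (smulLeftCLM_apply_apply (hasTemperateGrowth_cexp_I_mul_inner _ _) _ x).trans ?_
    rw [compSubConstCLM_apply, sub_eq_add_neg]
    rfl
  exists_le := by
    refine ⟨1 + ‖v‖, fun t ht x => ?_⟩
    have hx : ‖x‖ ≤ ‖x + -(t • v)‖ + ‖t • v‖ := by simpa using norm_add_le (x + -(t • v)) (t • v)
    have htv : ‖t • v‖ ≤ ‖v‖ := by
      rw [norm_smul]
      exact mul_le_of_le_one_left (norm_nonneg v) ht
    change _ ≤ (1 + ‖v‖) * (1 + ‖x + -(t • v)‖)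
    nlinarith [mul_nonneg (norm_nonneg v) (norm_nonneg (x + -(t • v)))]

theorem hasDerivAt_displacementFlow (v w : E) (f : 𝓢(E, ℂ)) (x : E) :
    HasDerivAt (fun t => (displacementFlow v w).onSchwartz t f x)
      (-Complex.I * (momentumOp v - positionOp w) f x) 0 := by
  simp only [(displacementFlow v w).onSchwartz_apply]
  have hphase : HasDerivAt (fun t : ℝ => ((displacementFlow v w).phaseMap t).phase x)
      (Complex.I * inner ℝ w x) 0 := by
    have h : HasDerivAt (fun t : ℝ => inner ℝ (t • w) x + -(t ^ 2 * inner ℝ w v) / 2)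
        (inner ℝ w x) 0 := by
      simp only [real_inner_smul_left]
      exact ((hasDerivAt_mul_const _).add
        (((hasDerivAt_pow 2 (0 : ℝ)).mul_const _).neg.div_const 2)).congr_deriv (by simp)
    refine (h.ofReal_comp.const_mul Complex.I).cexp.congr_deriv ?_
    simp
  have htrans : HasDerivAt (fun t : ℝ => f (((displacementFlow v w).phaseMap t).map x))
      (-lineDeriv ℝ f x v) 0 := by
    have h : HasDerivAt (fun t : ℝ => x + -(t • v)) (-v) 0 := by
      simpa using ((hasDerivAt_id (0 : ℝ)).smul_const v).neg.const_add x
    have hf : HasFDerivAt f (fderiv ℝ f x) (x + -((0 : ℝ) • v)) := by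
      simpa using f.hasFDerivAt x
    refine (hf.comp_hasDerivAt 0 h).congr_deriv ?_
    rw [map_neg, f.differentiableAt.lineDeriv_eq_fderiv]
  refine (hphase.mul htrans).congr_deriv ?_
  simp only [displacementFlow, displacement, _root_.sub_apply, momentumOp_apply, positionOp_apply]
  simp
  linear_combination (-(lineDeriv ℝ f x v)) * Complex.I_mul_I

theorem expNegI_momentumOp_sub_positionOp (v w : E) (f : L2 E) :
    expNegI (momentumOp v - positionOp w) f =
      (displacement (-inner ℝ w v / 2) (-v) w).op f := by
  rw [(displacementFlow v w).expNegI_eq_op (hasDerivAt_displacementFlow v w)]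
  simp [displacementFlow]

end Displacement

theorem weyl_apply (q p : ℝ) (f : L2 ℝ) :
    weyl q p f = (displacement (-(q * p) / 2) (-q) p).op f := by
  have hA : (q : ℂ) • momentumOp (1 : ℝ) - (p : ℂ) • positionOp (1 : ℝ) =
      momentumOp q - positionOp p := by
    ext g x
    have hline : lineDeriv ℝ g x q = q * lineDeriv ℝ g x 1 := by
      rw [g.differentiableAt.lineDeriv_eq_fderiv, g.differentiableAt.lineDeriv_eq_fderiv,
        ← Complex.real_smul, ← map_smul, smul_eq_mul, mul_one]
    simp [momentumOp_apply, positionOp_apply, hline]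
    ring
  rw [weyl, hA, expNegI_momentumOp_sub_positionOp]
  simp

theorem adjoint_weyl_apply (q p : ℝ) (f : L2 ℝ) :
    ContinuousLinearMap.adjoint (weyl q p) f = (displacement (-(q * p) / 2) q (-p)).op f := by
  have hinv : weyl q p ((displacement (-(q * p) / 2) q (-p)).op f) = f := by
    have hθ : -(q * p) / 2 = inner ℝ p (-q) - -(q * p) / 2 := by
      simp only [inner_neg_right, Real.inner_apply]
      ring
    have h := displacement_op_neg (-(q * p) / 2) (-q) p f
    rwa [← hθ, neg_neg, ← weyl_apply] at h
  refine ext_inner_left ℂ fun g => ?_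
  rw [ContinuousLinearMap.adjoint_inner_right, ← hinv, weyl_apply, weyl_apply,
    LinearIsometry.inner_map_map, ← weyl_apply, hinv]

/-! ### Linear flows -/

theorem exp_eq_sum_of_pow_eq_zero {𝔸 : Type*} [Ring 𝔸] [Algebra ℝ 𝔸] [TopologicalSpace 𝔸]
    [IsTopologicalRing 𝔸] {a : 𝔸} {k : ℕ} (ha : a ^ k = 0) :
    NormedSpace.exp a = ∑ n ∈ Finset.range k, (n.factorial : ℝ)⁻¹ • a ^ n := by
  rw [NormedSpace.exp_eq_tsum ℝ]
  refine tsum_eq_sum fun n hn => ?_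
  rw [pow_eq_zero_of_le (not_lt.1 (Finset.mem_range.not.1 hn)) ha, smul_zero]

theorem isNilpotent_exp_sub_one {𝔸 : Type*} [Ring 𝔸] [Algebra ℝ 𝔸] [TopologicalSpace 𝔸]
    [IsTopologicalRing 𝔸] {a : 𝔸} (ha : IsNilpotent a) :
    IsNilpotent (NormedSpace.exp a - 1) := by
  obtain ⟨k, hk⟩ := ha
  have hexp : NormedSpace.exp a - 1 =
      a * ∑ n ∈ Finset.range k, ((n + 1).factorial : ℝ)⁻¹ • a ^ n := by
    rw [exp_eq_sum_of_pow_eq_zero (pow_eq_zero_of_le k.le_succ hk), Finset.sum_range_succ']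
    simp [Finset.mul_sum, pow_succ']
  rw [hexp]
  exact Commute.isNilpotent_mul_right
    (Commute.sum_right _ _ _ fun n _ => ((Commute.refl a).pow_right n).smul_right _) ⟨k, hk⟩

theorem det_one_add_of_isNilpotent {R M : Type*} [CommRing R] [IsDomain R] [AddCommGroup M]
    [Module R M] [Module.Finite R M] [Module.Free R M] {f : Module.End R M} (hf : IsNilpotent f) :
    LinearMap.det (1 + f) = 1 := by
  have h := LinearMap.eval_charpoly (-f) 1
  rw [hf.neg.charpoly_eq_X_pow_finrank, map_one, sub_neg_eq_add] at h
  simpa using h.symm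

section LinearFlow

variable {E : Type} [NormedAddCommGroup E] [InnerProductSpace ℝ E] [FiniteDimensional ℝ E]

theorem measurePreserving_exp_of_isNilpotent [MeasurableSpace E] [BorelSpace E] {N : E →L[ℝ] E}
    (hN : IsNilpotent N) :
    MeasurePreserving (NormedSpace.exp N : E →L[ℝ] E) (volume : Measure E) volume := by
  have hdet : LinearMap.det (NormedSpace.exp N : E →L[ℝ] E).toLinearMap = 1 := by
    have h : (NormedSpace.exp N : E →L[ℝ] E).toLinearMap =
        1 + (NormedSpace.exp N - 1 : E →L[ℝ] E).toLinearMap := by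
      ext x
      simp
    rw [h]
    exact det_one_add_of_isNilpotent
      ((isNilpotent_exp_sub_one hN).map
        (ContinuousLinearMap.toLinearMapRingHom (R₁ := ℝ) (M₁ := E)))
  have hmap := Measure.map_linearMap_addHaar_eq_smul_addHaar (volume : Measure E)
    (f := (NormedSpace.exp N : E →L[ℝ] E).toLinearMap) (by rw [hdet]; exact one_ne_zero)
  refine ⟨(NormedSpace.exp N : E →L[ℝ] E).measurable, hmap.trans ?_⟩
  rw [hdet]
  simp

theorem exp_add_smul (N : E →L[ℝ] E) (s t : ℝ) :
    NormedSpace.exp ((s + t) • N) = NormedSpace.exp (s • N) * NormedSpace.exp (t • N) := by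
  let _ : NormedAlgebra ℚ (E →L[ℝ] E) := .restrictScalars ℚ ℝ _
  rw [add_smul]
  exact NormedSpace.exp_add_of_commute (((Commute.refl N).smul_left s).smul_right t)

theorem exp_smul_apply_exp_neg_smul (N : E →L[ℝ] E) (t : ℝ) (x : E) :
    NormedSpace.exp (t • N) (NormedSpace.exp (-t • N) x) = x := by
  rw [← mul_apply_eq_comp, ← exp_add_smul, add_neg_cancel, zero_smul,
    NormedSpace.exp_zero, one_apply_eq_self]

variable [MeasurableSpace E] [BorelSpace E]

/-- The group of composition operators `f ↦ f ∘ exp(tN)` of a nilpotent linear vector field. -/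
def linearFlow (N : E →L[ℝ] E) (hN : IsNilpotent N) : PhaseFlow E where
  phaseMap t :=
    { phase := fun _ => 1
      map := (NormedSpace.exp (t • N) : E →L[ℝ] E)
      measurable_phase := measurable_const
      norm_phase := fun _ => norm_one
      measurePreserving := measurePreserving_exp_of_isNilpotent (hN.smul t) }
  phaseMap_add s t := by
    ext x
    · exact (mul_one 1).symm
    · have h := exp_add_smul N t s
      rw [add_comm t s] at h
      exact DFunLike.congr_fun h x
  onSchwartz t := compCLMOfContinuousLinearEquiv ℂ
    (ContinuousLinearEquiv.equivOfInverse (NormedSpace.exp (t • N)) (NormedSpace.exp (-t • N))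
      (fun x => by simpa using exp_smul_apply_exp_neg_smul N (-t) x)
      (exp_smul_apply_exp_neg_smul N t))
  onSchwartz_apply t f x := (one_mul _).symm
  exists_le := by
    have hcont : Continuous fun t : ℝ => NormedSpace.exp (-t • N) :=
      continuous_iff_continuousAt.2 fun t =>
        ((hasDerivAt_exp_smul_const (𝕂 := ℝ) N (-t)).continuousAt.comp continuousAt_neg)
    obtain ⟨C, hC⟩ := (isCompact_Icc (a := (-1 : ℝ)) (b := 1)).exists_bound_of_continuousOn
      hcont.continuousOn
    refine ⟨1 + C, fun t ht x => ?_⟩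
    have hCt : ‖NormedSpace.exp (-t • N)‖ ≤ C := hC t (abs_le.1 ht)
    have hx := (NormedSpace.exp (-t • N)).le_of_opNorm_le hCt (NormedSpace.exp (t • N) x)
    have hinv := exp_smul_apply_exp_neg_smul N (-t) x
    rw [neg_neg] at hinv
    rw [hinv] at hx
    change _ ≤ (1 + C) * (1 + ‖NormedSpace.exp (t • N) x‖)
    nlinarith [norm_nonneg (NormedSpace.exp (t • N) x), (norm_nonneg _).trans hCt]

theorem hasDerivAt_linearFlow (N : E →L[ℝ] E) (hN : IsNilpotent N) (f : 𝓢(E, ℂ)) (x : E) :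
    HasDerivAt (fun t => (linearFlow N hN).onSchwartz t f x) (fderiv ℝ f x (N x)) 0 := by
  have hmap : HasDerivAt (fun t : ℝ => NormedSpace.exp (t • N) x) (N x) 0 := by
    simpa using (hasDerivAt_exp_smul_const' (𝕂 := ℝ) N 0).clm_apply (hasDerivAt_const 0 x)
  have hf : HasFDerivAt f (fderiv ℝ f x) (NormedSpace.exp ((0 : ℝ) • N) x) := by
    simpa using f.hasFDerivAt x
  exact hf.comp_hasDerivAt 0 hmap

theorem expNegI_eq_linearFlow_op {A : 𝓢(E, ℂ) →L[ℂ] 𝓢(E, ℂ)} {N : E →L[ℝ] E}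
    (hN : IsNilpotent N) (hA : ∀ f x, A f x = Complex.I * fderiv ℝ f x (N x)) (f : L2 E) :
    expNegI A f = ((linearFlow N hN).phaseMap 1).op f := by
  refine (linearFlow N hN).expNegI_eq_op (fun f x => ?_) f
  rw [hA, ← mul_assoc, neg_mul, Complex.I_mul_I, neg_neg, one_mul]
  exact hasDerivAt_linearFlow N hN f x

end LinearFlow

/-! ### The coupling -/

theorem inner_dir (i : Fin 3) (x : R3) : inner ℝ (dir i) x = x i := by
  simp [dir, EuclideanSpace.inner_single_left]

theorem momentumOp_positionOp_apply {E : Type} [NormedAddCommGroup E] [InnerProductSpace ℝ E]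
    {v w : E} (h : inner ℝ w v = (0 : ℝ)) (f : 𝓢(E, ℂ)) (x : E) :
    momentumOp v (positionOp w f) x = (inner ℝ w x : ℝ) * momentumOp v f x := by
  have hline (t : ℝ) : inner ℝ w (x + t • v) = (inner ℝ w x : ℝ) := by
    rw [inner_add_right, real_inner_smul_right, h, mul_zero, add_zero]
  simp only [momentumOp_apply, lineDeriv, positionOp_apply, hline, deriv_const_mul_field]
  ring

/-- The vector field `(μ q₂, -λ q - (λμκ/2) q₂, 0)` along which the Hamiltonian differentiates. -/
def couplingField (lam mu κ : ℝ) : R3 →L[ℝ] R3 :=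
  mu • (innerSL ℝ (dir 2)).smulRight (dir 0) -
    (lam • innerSL ℝ (dir 0) + (lam * mu / 2 * κ) • innerSL ℝ (dir 2)).smulRight (dir 1)

theorem couplingField_apply (lam mu κ : ℝ) (x : R3) :
    couplingField lam mu κ x =
      (mu * x 2) • dir 0 - (lam * x 0 + lam * mu / 2 * κ * x 2) • dir 1 := by
  simp [couplingField, inner_dir, mul_smul, mul_assoc]

theorem couplingField_pow_three (lam mu κ : ℝ) : couplingField lam mu κ ^ 3 = 0 := by
  ext x i
  simp only [pow_succ, pow_zero, one_mul, mul_apply_eq_comp, couplingField_apply]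
  simp [dir]

theorem hamiltonian_apply (lam mu κ : ℝ) (f : 𝓢(R3, ℂ)) (x : R3) :
    hamiltonian lam mu κ f x = Complex.I * fderiv ℝ f x (couplingField lam mu κ x) := by
  have h02 : inner ℝ (dir 2) (dir 0) = (0 : ℝ) := by
    rw [inner_dir]
    simp [dir]
  have h12 : inner ℝ (dir 2) (dir 1) = (0 : ℝ) := by
    rw [inner_dir]
    simp [dir]
  simp only [hamiltonian, _root_.add_apply, _root_.sub_apply, _root_.smul_apply,
    ContinuousLinearMap.comp_apply, momentumOp_positionOp_apply h02,
    momentumOp_positionOp_apply h12, positionOp_apply, momentumOp_apply, inner_dir,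
    f.differentiableAt.lineDeriv_eq_fderiv, couplingField_apply, map_sub, map_smul, smul_eq_mul,
    Complex.real_smul]
  push_cast
  ring

/-- The measure preserving transformation that implements the coupling. -/
def couplingMap (lam mu κ : ℝ) : PhaseMap (volume : Measure R3) :=
  (linearFlow (couplingField lam mu κ) ⟨3, couplingField_pow_three lam mu κ⟩).phaseMap 1

theorem coupling_apply (lam mu κ : ℝ) (f : L2 R3) :
    coupling lam mu κ f = (couplingMap lam mu κ).op f :=
  expNegI_eq_linearFlow_op _ (hamiltonian_apply lam mu κ) f

theorem couplingMap_map (lam mu κ : ℝ) (x : R3) :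
    (couplingMap lam mu κ).map x = x + (mu * x 2) • dir 0 -
      (lam * x 0 + lam * mu / 2 * (κ + 1) * x 2) • dir 1 := by
  change NormedSpace.exp ((1 : ℝ) • couplingField lam mu κ) x = _
  rw [one_smul, exp_eq_sum_of_pow_eq_zero (couplingField_pow_three lam mu κ)]
  ext i
  simp only [Finset.sum_range_succ, Finset.sum_range_zero, pow_succ, pow_zero, one_mul]
  fin_cases i <;> simp [couplingField_apply, dir]
  ring

/-! ### Spectral measures under displacements -/

section Fourier

variable {E : Type} [NormedAddCommGroup E] [InnerProductSpace ℝ E] [MeasurableSpace E]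
  [BorelSpace E] [FiniteDimensional ℝ E]

theorem fourier_toLp_ae_eq {f : E → ℂ} (hf : Integrable f volume) (hf' : MemLp f 2 volume) :
    (𝓕 hf'.toLp : L2 E) =ᵐ[volume] 𝓕 f := by
  have hcont : Continuous (𝓕 f) :=
    VectorFourier.fourierIntegral_continuous (L := innerₗ E) Real.continuous_fourierChar
      continuous_inner hf
  refine ae_eq_of_integral_contDiff_smul_eq ((Lp.memLp _).locallyIntegrable one_le_two)
    hcont.locallyIntegrable fun g hg hg' => ?_
  let φ : 𝓢(E, ℂ) := (hg'.comp_left rfl : HasCompactSupport (Complex.ofRealCLM ∘ g)).toSchwartzMap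
    (Complex.ofRealCLM.contDiff.comp hg)
  have hdistr : ∫ x, φ x • (𝓕 hf'.toLp : L2 E) x = ∫ x, (𝓕 φ) x • (hf'.toLp : L2 E) x := by
    rw [← Lp.toTemperedDistribution_apply, ← Lp.toTemperedDistribution_apply,
      ← Lp.fourier_toTemperedDistribution_eq]
    rfl
  have hae : ∫ x, (𝓕 φ) x • (hf'.toLp : L2 E) x = ∫ x, (𝓕 φ) x • f x := by
    refine integral_congr_ae ?_
    filter_upwards [hf'.coeFn_toLp] with x hx
    rw [hx]
  have hflip : ∫ x, (𝓕 φ) x • f x = ∫ x, φ x • 𝓕 f x := by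
    simpa using! VectorFourier.integral_fourierIntegral_smul_eq_flip (L := innerₗ E)
      Real.continuous_fourierChar continuous_inner φ.integrable hf
  simpa using! hdistr.trans (hae.trans hflip)

theorem fourier_displacement_apply (θ : ℝ) (v w : E) (f : E → ℂ) (ξ : E) :
    𝓕 (fun x => (displacement θ v w).phase x * f ((displacement θ v w).map x)) ξ =
      (displacement (θ - inner ℝ w v) (-((2 * Real.pi)⁻¹ • w)) ((2 * Real.pi) • v)).phase ξ *
        𝓕 f (ξ + -((2 * Real.pi)⁻¹ • w)) := by
  rw [Real.fourier_eq', Real.fourier_eq', ← integral_const_mul]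
  refine Eq.trans ?_ (integral_add_right_eq_self (μ := (volume : Measure E)) _ v)
  congr 1
  funext x
  simp only [displacement, smul_eq_mul, ← mul_assoc, ← Complex.exp_add]
  congr 2
  have hw : inner ℝ x ((2 * Real.pi)⁻¹ • w) = (2 * Real.pi)⁻¹ * inner ℝ w x := by
    rw [real_inner_smul_right, real_inner_comm]
  have hv : inner ℝ v ((2 * Real.pi)⁻¹ • w) = (2 * Real.pi)⁻¹ * inner ℝ w v := by
    rw [real_inner_smul_right, real_inner_comm]
  have hv' : inner ℝ ((2 * Real.pi) • v) ξ = 2 * Real.pi * inner ℝ v ξ :=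
    real_inner_smul_left _ _ _
  simp only [inner_add_left, inner_add_right, inner_neg_right, hw, hv, hv']
  push_cast
  field_simp
  ring

theorem fourier_displacement_op (θ : ℝ) (v w : E) (f : L2 E) :
    𝓕 ((displacement θ v w).op f) =
      (displacement (θ - inner ℝ w v) (-((2 * Real.pi)⁻¹ • w)) ((2 * Real.pi) • v)).op (𝓕 f) := by
  set c := displacement θ v w
  set d := displacement (θ - inner ℝ w v) (-((2 * Real.pi)⁻¹ • w)) ((2 * Real.pi) • v)
  have hclosed : IsClosed {f : L2 E | 𝓕 (c.op f) = d.op (𝓕 f)} :=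
    isClosed_eq ((Lp.fourierTransformₗᵢ E ℂ).continuous.comp c.op.continuous)
      (d.op.continuous.comp (Lp.fourierTransformₗᵢ E ℂ).continuous)
  refine denseRange_schwartz_toLp.induction_on (p := fun f => 𝓕 (c.op f) = d.op (𝓕 f)) f
    hclosed fun f => ?_
  have hf := f.memLp 2 (volume : Measure E)
  have hint := memLp_one_iff_integrable.1 (c.memLp (f.memLp 1 (volume : Measure E)))
  rw [toLp, c.op_toLp hf]
  ext1
  filter_upwards [fourier_toLp_ae_eq hint (c.memLp hf), d.coeFn_op (𝓕 hf.toLp),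
    d.ae_comp (fourier_toLp_ae_eq f.integrable hf)] with ξ h1 h2 h3
  rw [h1, h2, h3, fourier_displacement_apply]
  rfl

theorem positionPVM_displacement_op (θ : ℝ) (v w e : E) {X : Set ℝ} (hX : MeasurableSet X)
    (f : L2 E) :
    positionPVM e ((· + inner ℝ e v) ⁻¹' X) ((displacement θ v w).op f) =
      (displacement θ v w).op (positionPVM e X f) := by
  have hs : MeasurableSet {x : E | inner ℝ e x ∈ X} :=
    (by fun_prop : Measurable fun x : E => inner ℝ e x) hX
  rw [positionPVM, positionPVM, ← PhaseMap.indicatorOp_preimage_op _ hs]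
  simp only [displacement, Set.preimage_ofPred_eq, inner_add_right, Set.mem_preimage]

theorem momentumPVM_apply (e : E) (Y : Set ℝ) (f : L2 E) :
    momentumPVM e Y f = 𝓕⁻ (indicatorOp {ξ : E | 2 * Real.pi * inner ℝ e ξ ∈ Y} (𝓕 f)) :=
  rfl

theorem momentumPVM_displacement_op (θ : ℝ) (v w e : E) {Y : Set ℝ} (hY : MeasurableSet Y)
    (f : L2 E) :
    momentumPVM e ((· - inner ℝ e w) ⁻¹' Y) ((displacement θ v w).op f) =
      (displacement θ v w).op (momentumPVM e Y f) := by
  have hs : MeasurableSet {ξ : E | 2 * Real.pi * inner ℝ e ξ ∈ Y} :=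
    (by fun_prop : Measurable fun ξ : E => 2 * Real.pi * inner ℝ e ξ) hY
  apply (Lp.fourierTransformₗᵢ E ℂ).injective
  change 𝓕 (momentumPVM e ((· - inner ℝ e w) ⁻¹' Y) ((displacement θ v w).op f)) =
    𝓕 ((displacement θ v w).op (momentumPVM e Y f))
  rw [momentumPVM_apply, momentumPVM_apply, fourier_displacement_op, fourier_displacement_op,
    FourierTransform.fourier_fourierInv_eq, FourierTransform.fourier_fourierInv_eq,
    ← PhaseMap.indicatorOp_preimage_op _ hs]
  congr 2
  ext ξ
  simp only [displacement, Set.preimage_ofPred_eq, Set.mem_ofPred_eq, Set.mem_preimage,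
    inner_add_right, inner_neg_right, real_inner_smul_right]
  rw [mul_add, mul_neg, mul_inv_cancel_left₀ (by positivity), sub_eq_add_neg]

end Fourier

/-! ### Hilbert space tensor products -/

section HilbertBasis

variable {H K F : Type*} [NormedAddCommGroup H] [InnerProductSpace ℂ H] [NormedAddCommGroup K]
  [InnerProductSpace ℂ K] [NormedAddCommGroup F] [NormedSpace ℂ F] {ι κ : Type*}

theorem ext_hilbertBasis (b : HilbertBasis ι ℂ H) {A B : H →L[ℂ] F}
    (h : ∀ i, A (b i) = B (b i)) : A = B :=
  ContinuousLinearMap.ext_on (Submodule.dense_iff_topologicalClosure_eq_top.2 b.dense_span)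
    (Set.forall_mem_range.2 h)

theorem ext_hilbertBasis₂ (b : HilbertBasis ι ℂ H) (d : HilbertBasis κ ℂ K)
    {A B : H →L[ℂ] K →L[ℂ] F} (h : ∀ i j, A (b i) (d j) = B (b i) (d j)) : A = B :=
  ext_hilbertBasis b fun i => ext_hilbertBasis d (h i)

end HilbertBasis

/-- A realisation of a Hilbert space `L` as the tensor product of `H` and `K`: a bounded bilinear
map whose values multiply inner products and are total in `L`. -/
structure HilbertTensor (H K L : Type*) [NormedAddCommGroup H] [InnerProductSpace ℂ H]
    [NormedAddCommGroup K] [InnerProductSpace ℂ K] [NormedAddCommGroup L]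
    [InnerProductSpace ℂ L] where
  /-- The product vector `h ⊗ k`. -/
  tmul : H →L[ℂ] K →L[ℂ] L
  inner_tmul : ∀ h h' k k', inner ℂ (tmul h k) (tmul h' k') = inner ℂ h h' * inner ℂ k k'
  eq_zero_of_inner_tmul : ∀ f, (∀ h k, inner ℂ (tmul h k) f = 0) → f = 0

namespace HilbertTensor

variable {H K L M : Type*} [NormedAddCommGroup H] [InnerProductSpace ℂ H] [NormedAddCommGroup K]
  [InnerProductSpace ℂ K] [NormedAddCommGroup L] [InnerProductSpace ℂ L] [NormedAddCommGroup M]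
  [InnerProductSpace ℂ M] {ι κ : Type*}

/-- Transport of a tensor product along a unitary operator. -/
def trans (T : HilbertTensor H K L) (V : L ≃ₗᵢ[ℂ] M) : HilbertTensor H K M where
  tmul := ContinuousLinearMap.compL ℂ K L M V.toContinuousLinearEquiv ∘L T.tmul
  inner_tmul h h' k k' := (V.inner_map_map _ _).trans (T.inner_tmul h h' k k')
  eq_zero_of_inner_tmul f hf := by
    refine V.symm.map_eq_zero_iff.1 (T.eq_zero_of_inner_tmul _ fun h k => ?_)
    rw [← V.inner_map_map, V.apply_symm_apply]
    exact hf h k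

/-- Right factor transported along a unitary operator: `h ⊗' k = h ⊗ V k`. -/
def compRight (T : HilbertTensor H K L) (V : M ≃ₗᵢ[ℂ] K) : HilbertTensor H M L where
  tmul := (T.tmul.flip ∘L (V.toContinuousLinearEquiv : M →L[ℂ] K)).flip
  inner_tmul h h' k k' := by
    rw [← V.inner_map_map]
    exact T.inner_tmul h h' (V k) (V k')
  eq_zero_of_inner_tmul f hf := T.eq_zero_of_inner_tmul f fun h k => by
    simpa using! hf h (V.symm k)

theorem compRight_tmul (T : HilbertTensor H K L) (V : M ≃ₗᵢ[ℂ] K) (h : H) (m : M) :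
    (T.compRight V).tmul h m = T.tmul h (V m) := rfl

theorem ext_tmul [CompleteSpace L] [CompleteSpace M] (T : HilbertTensor H K L) {A B : L →L[ℂ] M}
    (h : ∀ a b, A (T.tmul a b) = B (T.tmul a b)) : A = B := by
  refine ContinuousLinearMap.adjoint.injective (ContinuousLinearMap.ext fun g => ?_)
  rw [← sub_eq_zero]
  refine T.eq_zero_of_inner_tmul _ fun a b => ?_
  rw [inner_sub_right, ContinuousLinearMap.adjoint_inner_right,
    ContinuousLinearMap.adjoint_inner_right, h, sub_self]

theorem orthonormal_tmul (T : HilbertTensor H K L) {v : ι → H} {w : κ → K} (hv : Orthonormal ℂ v)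
    (hw : Orthonormal ℂ w) : Orthonormal ℂ fun i : ι × κ => T.tmul (v i.1) (w i.2) := by
  classical
  rw [orthonormal_iff_ite] at hv hw ⊢
  rintro ⟨i, j⟩ ⟨i', j'⟩
  rw [T.inner_tmul, hv, hw, ite_zero_mul_ite_zero, one_mul]
  simp only [Prod.mk.injEq]

theorem orthogonal_span_tmul (T : HilbertTensor H K L) (b : HilbertBasis ι ℂ H)
    (d : HilbertBasis κ ℂ K) :
    (Submodule.span ℂ (Set.range fun i : ι × κ => T.tmul (b i.1) (d i.2)))ᗮ = ⊥ := by
  rw [Submodule.eq_bot_iff]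
  intro f hf
  rw [Submodule.mem_orthogonal] at hf
  have h0 : ContinuousLinearMap.compL ℂ K L ℂ (innerSL ℂ f) ∘L T.tmul = 0 :=
    ext_hilbertBasis₂ b d fun i j =>
      inner_eq_zero_symm.1 (hf _ (Submodule.subset_span ⟨(i, j), rfl⟩))
  exact T.eq_zero_of_inner_tmul f fun h k =>
    inner_eq_zero_symm.1 (congrArg (fun A : H →L[ℂ] K →L[ℂ] ℂ => A h k) h0)

variable [CompleteSpace L] [CompleteSpace M]

/-- The product of two Hilbert bases. -/
def basis (T : HilbertTensor H K L) (b : HilbertBasis ι ℂ H) (d : HilbertBasis κ ℂ K) :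
    HilbertBasis (ι × κ) ℂ L :=
  HilbertBasis.mkOfOrthogonalEqBot (T.orthonormal_tmul b.orthonormal d.orthonormal)
    (T.orthogonal_span_tmul b d)

theorem basis_apply (T : HilbertTensor H K L) (b : HilbertBasis ι ℂ H) (d : HilbertBasis κ ℂ K)
    (i : ι × κ) : T.basis b d i = T.tmul (b i.1) (d i.2) :=
  congrFun (HilbertBasis.coe_mkOfOrthogonalEqBot _ _) i

theorem exists_unitary [CompleteSpace H] [CompleteSpace K] (T : HilbertTensor H K L)
    (T' : HilbertTensor H K M) :
    ∃ V : L ≃ₗᵢ[ℂ] M, ∀ h k, V (T.tmul h k) = T'.tmul h k := by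
  classical
  obtain ⟨_, b, -⟩ := exists_hilbertBasis ℂ H
  obtain ⟨_, d, -⟩ := exists_hilbertBasis ℂ K
  let V := (T.basis b d).repr.trans (T'.basis b d).repr.symm
  have hV : (T.trans V).tmul = T'.tmul := ext_hilbertBasis₂ b d fun i j => by
    change V (T.tmul (b i) (d j)) = _
    rw [← T.basis_apply b d (i, j), LinearIsometryEquiv.trans_apply, HilbertBasis.repr_self,
      HilbertBasis.repr_symm_single, T'.basis_apply]
  exact ⟨V, fun h k => congrArg (fun A : H →L[ℂ] K →L[ℂ] M => A h k) hV⟩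

end HilbertTensor

section Prod

variable {α β : Type*} [MeasurableSpace α] [MeasurableSpace β] {μ : Measure α} {ν : Measure β}

theorem ae_eq_zero_of_setIntegral_prod_eq_zero {F : Type*} [NormedAddCommGroup F] [NormedSpace ℝ F]
    [CompleteSpace F] {ρ : Measure (α × β)} {f : α × β → F} (hf : Integrable f ρ)
    (h : ∀ s t, MeasurableSet s → MeasurableSet t → ∫ x in s ×ˢ t, f x ∂ρ = 0) : f =ᵐ[ρ] 0 := by
  have hprod : ∀ s t, MeasurableSet s → MeasurableSet t →
      ρ.withDensityᵥ f (s ×ˢ t) = ρ.withDensityᵥ 0 (s ×ˢ t) := fun s t hs ht => by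
    rw [withDensityᵥ_zero, withDensityᵥ_apply hf (hs.prod ht), h s t hs ht]
    rfl
  refine Integrable.ae_eq_of_withDensityᵥ_eq hf (integrable_zero _ _ _)
    (VectorMeasure.ext_of_generateFrom _ ?_ generateFrom_prod.symm isPiSystem_prod ?_)
  · rintro _ ⟨s, hs, t, ht, rfl⟩
    exact hprod s t hs ht
  · rw [← Set.univ_prod_univ]
    exact hprod _ _ .univ .univ

theorem ae_eq_zero_of_setIntegral_prod_eq_zero_of_sigmaFinite {F : Type*} [NormedAddCommGroup F]
    [NormedSpace ℝ F] [CompleteSpace F] [SigmaFinite μ] [SigmaFinite ν] {f : α × β → F}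
    (hf : ∀ s t, MeasurableSet s → MeasurableSet t → μ s < ⊤ → ν t < ⊤ →
      IntegrableOn f (s ×ˢ t) (μ.prod ν))
    (h : ∀ s t, MeasurableSet s → MeasurableSet t → μ s < ⊤ → ν t < ⊤ →
      ∫ x in s ×ˢ t, f x ∂μ.prod ν = 0) :
    f =ᵐ[μ.prod ν] 0 := by
  have hS := measurableSet_spanningSets μ
  have hT := measurableSet_spanningSets ν
  have hzero : ∀ n, f =ᵐ[(μ.prod ν).restrict (spanningSets μ n ×ˢ spanningSets ν n)] 0 := by
    intro n
    refine ae_eq_zero_of_setIntegral_prod_eq_zero (hf _ _ (hS n) (hT n)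
      (measure_spanningSets_lt_top μ n) (measure_spanningSets_lt_top ν n)) fun s t hs ht => ?_
    rw [Measure.restrict_restrict (hs.prod ht), Set.prod_inter_prod]
    exact h _ _ (hs.inter (hS n)) (ht.inter (hT n))
      (measure_inter_lt_top_of_right_ne_top (measure_spanningSets_lt_top μ n).ne)
      (measure_inter_lt_top_of_right_ne_top (measure_spanningSets_lt_top ν n).ne)
  have hunion := (ae_restrict_iUnion_iff _ fun x => f x = (0 : α × β → F) x).2 hzero
  rwa [Set.iUnion_prod_of_monotone (monotone_spanningSets μ) (monotone_spanningSets ν),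
    iUnion_spanningSets, iUnion_spanningSets, Set.univ_prod_univ, Measure.restrict_univ] at hunion

theorem memLp_two_mul_prod {f : α → ℂ} {g : β → ℂ} (hf : MemLp f 2 μ)
    (hg : MemLp g 2 ν) : MemLp (fun z : α × β => f z.1 * g z.2) 2 (μ.prod ν) := by
  have hfg : AEStronglyMeasurable (fun z : α × β => f z.1 * g z.2) (μ.prod ν) :=
    hf.1.comp_fst.mul hg.1.comp_snd
  rw [memLp_two_iff_integrable_sq_norm hfg]
  rw [memLp_two_iff_integrable_sq_norm hf.1] at hf
  rw [memLp_two_iff_integrable_sq_norm hg.1] at hg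
  simpa [mul_pow] using hf.mul_prod hg

/-- The function `f(x) g(y)`, as an element of `L²` of the product measure. -/
def lpMul (f : Lp ℂ 2 μ) (g : Lp ℂ 2 ν) : Lp ℂ 2 (μ.prod ν) :=
  (memLp_two_mul_prod (Lp.memLp f) (Lp.memLp g)).toLp

theorem coeFn_lpMul (f : Lp ℂ 2 μ) (g : Lp ℂ 2 ν) :
    lpMul f g =ᵐ[μ.prod ν] fun z => f z.1 * g z.2 :=
  (memLp_two_mul_prod (Lp.memLp f) (Lp.memLp g)).coeFn_toLp

theorem lpMul_toLp {f : α → ℂ} {g : β → ℂ} (hf : MemLp f 2 μ) (hg : MemLp g 2 ν) :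
    lpMul hf.toLp hg.toLp = (memLp_two_mul_prod hf hg).toLp := by
  ext1
  filter_upwards [coeFn_lpMul hf.toLp hg.toLp, (memLp_two_mul_prod hf hg).coeFn_toLp,
    Measure.quasiMeasurePreserving_fst.ae hf.coeFn_toLp,
    Measure.quasiMeasurePreserving_snd.ae hg.coeFn_toLp] with z h1 h2 h3 h4
  rw [h1, h2, h3, h4]

theorem lpMul_indicatorConstLp {s : Set α} {t : Set β} (hs : MeasurableSet s)
    (ht : MeasurableSet t) (hμs : μ s ≠ ⊤) (hνt : ν t ≠ ⊤) (hst : μ.prod ν (s ×ˢ t) ≠ ⊤) :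
    lpMul (indicatorConstLp 2 hs hμs (1 : ℂ)) (indicatorConstLp 2 ht hνt 1) =
      indicatorConstLp 2 (hs.prod ht) hst 1 := by
  refine (lpMul_toLp _ _).trans (MemLp.toLp_congr _ _ (Eventually.of_forall fun z => ?_))
  by_cases h1 : z.1 ∈ s <;> by_cases h2 : z.2 ∈ t <;> simp [Set.indicator, h1, h2]

variable [SFinite μ] [SFinite ν]

theorem inner_lpMul (f f' : Lp ℂ 2 μ) (g g' : Lp ℂ 2 ν) :
    inner ℂ (lpMul f g) (lpMul f' g') = inner ℂ f f' * inner ℂ g g' := by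
  rw [L2.inner_def, L2.inner_def, L2.inner_def, ← integral_prod_mul]
  refine integral_congr_ae ?_
  filter_upwards [coeFn_lpMul f g, coeFn_lpMul f' g'] with z h1 h2
  rw [h1, h2]
  simp only [RCLike.inner_apply, map_mul]
  ring

theorem norm_lpMul (f : Lp ℂ 2 μ) (g : Lp ℂ 2 ν) : ‖lpMul f g‖ = ‖f‖ * ‖g‖ := by
  have h : ‖lpMul f g‖ ^ 2 = (‖f‖ * ‖g‖) ^ 2 := by
    have h := inner_lpMul f f g g
    simp only [inner_self_eq_norm_sq_to_K] at h
    rw [mul_pow]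
    exact_mod_cast h
  exact (pow_left_inj₀ (norm_nonneg _) (by positivity) two_ne_zero).1 h

/-- The product `f(x) g(y)` as a bounded bilinear map. -/
def lpMulL : Lp ℂ 2 μ →L[ℂ] Lp ℂ 2 ν →L[ℂ] Lp ℂ 2 (μ.prod ν) :=
  LinearMap.mkContinuous₂
    (LinearMap.mk₂ ℂ lpMul
      (fun f f' g => by
        ext1
        filter_upwards [coeFn_lpMul (f + f') g, coeFn_lpMul f g, coeFn_lpMul f' g,
          Lp.coeFn_add (lpMul f g) (lpMul f' g),
          Measure.quasiMeasurePreserving_fst.ae (Lp.coeFn_add f f')] with z h1 h2 h3 h4 h5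
        rw [h4, Pi.add_apply, h1, h2, h3, h5, Pi.add_apply, add_mul])
      (fun c f g => by
        ext1
        filter_upwards [coeFn_lpMul (c • f) g, coeFn_lpMul f g, Lp.coeFn_smul c (lpMul f g),
          Measure.quasiMeasurePreserving_fst.ae (Lp.coeFn_smul c f)] with z h1 h2 h3 h4
        rw [h3, Pi.smul_apply, h1, h2, h4, Pi.smul_apply, smul_mul_assoc])
      (fun f g g' => by
        ext1
        filter_upwards [coeFn_lpMul f (g + g'), coeFn_lpMul f g, coeFn_lpMul f g',
          Lp.coeFn_add (lpMul f g) (lpMul f g'),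
          Measure.quasiMeasurePreserving_snd.ae (Lp.coeFn_add g g')] with z h1 h2 h3 h4 h5
        rw [h4, Pi.add_apply, h1, h2, h3, h5, Pi.add_apply, mul_add])
      (fun c f g => by
        ext1
        filter_upwards [coeFn_lpMul f (c • g), coeFn_lpMul f g, Lp.coeFn_smul c (lpMul f g),
          Measure.quasiMeasurePreserving_snd.ae (Lp.coeFn_smul c g)] with z h1 h2 h3 h4
        rw [h3, Pi.smul_apply, h1, h2, h4, Pi.smul_apply, mul_smul_comm]))
    1 fun f g => by
      rw [one_mul]
      exact (norm_lpMul f g).le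

end Prod

section SigmaFinite

variable {α β : Type*} [MeasurableSpace α] [MeasurableSpace β] {μ : Measure α} {ν : Measure β}
  [SigmaFinite μ] [SigmaFinite ν]

theorem eq_zero_of_inner_lpMul {f : Lp ℂ 2 (μ.prod ν)}
    (hf : ∀ g h, inner ℂ (lpMul g h) f = 0) : f = 0 := by
  have hprod : ∀ s t, μ s < ⊤ → ν t < ⊤ → μ.prod ν (s ×ˢ t) < ⊤ := fun s t hs ht => by
    rw [Measure.prod_prod]
    exact ENNReal.mul_lt_top hs ht
  rw [Lp.eq_zero_iff_ae_eq_zero]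
  refine ae_eq_zero_of_setIntegral_prod_eq_zero_of_sigmaFinite (fun s t _ _ hs' ht' => ?_)
    fun s t hs ht hs' ht' => ?_
  · have : IsFiniteMeasure ((μ.prod ν).restrict (s ×ˢ t)) :=
      isFiniteMeasure_restrict.2 (hprod s t hs' ht').ne
    exact ((Lp.memLp f).restrict _).integrable one_le_two
  · rw [← L2.inner_indicatorConstLp_one (𝕜 := ℂ) (hs.prod ht) (hprod s t hs' ht').ne f,
      ← lpMul_indicatorConstLp hs ht hs'.ne ht'.ne, hf]

variable (μ ν) in
/-- `L²(μ × ν)` as the Hilbert space tensor product of `L²(μ)` and `L²(ν)`. -/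
def lpTensor : HilbertTensor (Lp ℂ 2 μ) (Lp ℂ 2 ν) (Lp ℂ 2 (μ.prod ν)) where
  tmul := lpMulL
  inner_tmul := inner_lpMul
  eq_zero_of_inner_tmul _ := eq_zero_of_inner_lpMul

end SigmaFinite

/-- Composition with a measure-preserving equivalence, as a unitary operator. -/
def lpCompEquiv {α β : Type*} [MeasurableSpace α] [MeasurableSpace β] {μ : Measure α}
    {ν : Measure β} (e : α ≃ᵐ β) (he : MeasurePreserving e μ ν) : Lp ℂ 2 ν ≃ₗᵢ[ℂ] Lp ℂ 2 μ :=
  LinearIsometryEquiv.ofSurjective (Lp.compMeasurePreservingₗᵢ ℂ e he) fun f => by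
    refine ⟨Lp.compMeasurePreserving e.symm he.symm f, ?_⟩
    change Lp.compMeasurePreserving e he (Lp.compMeasurePreserving e.symm he.symm f) = f
    rw [← Lp.compMeasurePreserving_comp_apply]
    ext1
    filter_upwards [Lp.coeFn_compMeasurePreserving f (he.symm.comp he)] with x hx
    rw [hx, Function.comp_apply, Function.comp_apply, e.symm_apply_apply]

section Splitting

variable {E F G : Type} [NormedAddCommGroup E] [InnerProductSpace ℝ E] [MeasurableSpace E]
  [BorelSpace E] [FiniteDimensional ℝ E] [NormedAddCommGroup F] [InnerProductSpace ℝ F]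
  [MeasurableSpace F] [BorelSpace F] [FiniteDimensional ℝ F] [NormedAddCommGroup G]
  [InnerProductSpace ℝ G] [MeasurableSpace G] [BorelSpace G] [FiniteDimensional ℝ G]
  {e : G ≃ᵐ E × F} (he : MeasurePreserving e volume volume)

/-- `L²(G)` as the tensor product of `L²(E)` and `L²(F)`, along a splitting `e` of the
coordinates of `G`: the product vector of `f` and `g` is `x ↦ f((e x).1) g((e x).2)`. -/
def splitTensor : HilbertTensor (L2 E) (L2 F) (L2 G) :=
  (lpTensor volume volume).trans (lpCompEquiv e he)

theorem coeFn_splitTensor_tmul (f : L2 E) (g : L2 F) :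
    (splitTensor he).tmul f g =ᵐ[volume] fun x => f (e x).1 * g (e x).2 := by
  filter_upwards [Lp.coeFn_compMeasurePreserving (lpMul f g) he,
    he.quasiMeasurePreserving.ae (coeFn_lpMul f g)] with x h1 h2
  exact h1.trans h2

theorem splitTensor_tmul_toLp {f : E → ℂ} {g : F → ℂ} (hf : MemLp f 2) (hg : MemLp g 2) :
    (splitTensor he).tmul hf.toLp hg.toLp =
      ((memLp_two_mul_prod hf hg).comp_measurePreserving he).toLp := by
  change Lp.compMeasurePreserving e he (lpMul hf.toLp hg.toLp) = _
  rw [lpMul_toLp]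
  exact Lp.toLp_compMeasurePreserving (memLp_two_mul_prod hf hg) he

theorem indicatorOp_splitTensor_tmul {s : Set E} {t : Set F} (hs : MeasurableSet s)
    (ht : MeasurableSet t) (f : L2 E) (g : L2 F) :
    indicatorOp (e ⁻¹' (s ×ˢ t)) ((splitTensor he).tmul f g) =
      (splitTensor he).tmul (indicatorOp s f) (indicatorOp t g) := by
  have hfst := Measure.quasiMeasurePreserving_fst.comp he.quasiMeasurePreserving
  have hsnd := Measure.quasiMeasurePreserving_snd.comp he.quasiMeasurePreserving
  ext1
  filter_upwards [coeFn_indicatorOp (e.measurable (hs.prod ht)) ((splitTensor he).tmul f g),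
    coeFn_splitTensor_tmul he f g, coeFn_splitTensor_tmul he (indicatorOp s f) (indicatorOp t g),
    hfst.ae (coeFn_indicatorOp hs f), hsnd.ae (coeFn_indicatorOp ht g)] with x h1 h2 h3 h4 h5
  simp only [Function.comp_apply] at h4 h5
  rw [h1, h3, h4, h5]
  by_cases hx1 : (e x).1 ∈ s <;> by_cases hx2 : (e x).2 ∈ t <;>
    simp [Set.indicator, hx1, hx2, h2]

theorem indicatorOp_univ (f : L2 E) : indicatorOp Set.univ f = f := by
  ext1
  filter_upwards [coeFn_indicatorOp MeasurableSet.univ f] with x hx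
  rw [hx, Set.indicator_univ]

theorem positionPVM_splitTensor_tmul {a : G} {a' : E}
    (ha : ∀ x, inner ℝ a x = inner ℝ a' (e x).1) {X : Set ℝ} (hX : MeasurableSet X) (f : L2 E)
    (g : L2 F) :
    positionPVM a X ((splitTensor he).tmul f g) =
      (splitTensor he).tmul (positionPVM a' X f) g := by
  have hs : MeasurableSet {y : E | inner ℝ a' y ∈ X} := (innerSL ℝ a').measurable hX
  have hset : {x : G | inner ℝ a x ∈ X} = e ⁻¹' ({y : E | inner ℝ a' y ∈ X} ×ˢ Set.univ) := by
    ext x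
    simp [ha]
  rw [positionPVM, hset, indicatorOp_splitTensor_tmul he hs .univ, indicatorOp_univ]
  rfl

variable (hinner : ∀ x y, inner ℝ x y = inner ℝ (e x).1 (e y).1 + inner ℝ (e x).2 (e y).2)
include he hinner

theorem fourier_mul_split (f : E → ℂ) (g : F → ℂ) (ξ : G) :
    𝓕 (fun x => f (e x).1 * g (e x).2) ξ = 𝓕 f (e ξ).1 * 𝓕 g (e ξ).2 := by
  rw [Real.fourier_eq', Real.fourier_eq', Real.fourier_eq', ← integral_prod_mul,
    ← Measure.volume_eq_prod, ← he.integral_comp']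
  refine integral_congr_ae (Eventually.of_forall fun x => ?_)
  simp only [hinner x ξ, smul_eq_mul, mul_add, Complex.ofReal_add, add_mul, Complex.exp_add]
  ring

theorem fourier_splitTensor_tmul_toLp (f : 𝓢(E, ℂ)) (g : 𝓢(F, ℂ)) :
    𝓕 ((splitTensor he).tmul (f.toLp 2) (g.toLp 2)) =
      (splitTensor he).tmul (𝓕 (f.toLp 2)) (𝓕 (g.toLp 2)) := by
  have hf := f.integrable (μ := volume)
  have hg := g.integrable (μ := volume)
  have hfg : Integrable (fun x => f (e x).1 * g (e x).2) volume :=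
    he.integrable_comp_of_integrable (hf.mul_prod hg)
  have hfst := Measure.quasiMeasurePreserving_fst.comp he.quasiMeasurePreserving
  have hsnd := Measure.quasiMeasurePreserving_snd.comp he.quasiMeasurePreserving
  have htmul : (splitTensor he).tmul (f.toLp 2) (g.toLp 2) = _ :=
    splitTensor_tmul_toLp he (f.memLp 2) (g.memLp 2)
  rw [htmul]
  ext1
  filter_upwards [fourier_toLp_ae_eq hfg
      ((memLp_two_mul_prod (f.memLp 2) (g.memLp 2)).comp_measurePreserving he),
    coeFn_splitTensor_tmul he (𝓕 (f.toLp 2)) (𝓕 (g.toLp 2)),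
    hfst.ae (fourier_toLp_ae_eq hf (f.memLp 2)),
    hsnd.ae (fourier_toLp_ae_eq hg (g.memLp 2))] with ξ h1 h2 h3 h4
  exact h1.trans ((fourier_mul_split he hinner f g ξ).trans
    (h2.trans (congrArg₂ (· * ·) h3 h4)).symm)

theorem fourier_splitTensor_tmul (f : L2 E) (g : L2 F) :
    𝓕 ((splitTensor he).tmul f g) = (splitTensor he).tmul (𝓕 f) (𝓕 g) := by
  have hE : Continuous (𝓕 : L2 E → L2 E) := (Lp.fourierTransformₗᵢ E ℂ).continuous
  have hF : Continuous (𝓕 : L2 F → L2 F) := (Lp.fourierTransformₗᵢ F ℂ).continuous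
  have hG : Continuous (𝓕 : L2 G → L2 G) := (Lp.fourierTransformₗᵢ G ℂ).continuous
  have htmul : Continuous fun z : L2 E × L2 F => (splitTensor he).tmul z.1 z.2 :=
    (splitTensor he).tmul.continuous₂
  have hright : Continuous fun z : L2 E × L2 F => (splitTensor he).tmul (𝓕 z.1) (𝓕 z.2) :=
    htmul.comp (f := fun z : L2 E × L2 F => (𝓕 z.1, 𝓕 z.2))
      ((hE.comp continuous_fst).prodMk (hF.comp continuous_snd))
  have hclosed : IsClosed {z : L2 E × L2 F | 𝓕 ((splitTensor he).tmul z.1 z.2) =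
      (splitTensor he).tmul (𝓕 z.1) (𝓕 z.2)} :=
    isClosed_eq (hG.comp htmul) hright
  exact (denseRange_schwartz_toLp.prodMap denseRange_schwartz_toLp).induction_on
    (p := fun z => 𝓕 ((splitTensor he).tmul z.1 z.2) = (splitTensor he).tmul (𝓕 z.1) (𝓕 z.2))
    (f, g) hclosed fun z => fourier_splitTensor_tmul_toLp he hinner z.1 z.2

theorem momentumPVM_splitTensor_tmul {b : G} {b' : F}
    (hb : ∀ x, inner ℝ b x = inner ℝ b' (e x).2) {Y : Set ℝ} (hY : MeasurableSet Y) (f : L2 E)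
    (g : L2 F) :
    momentumPVM b Y ((splitTensor he).tmul f g) =
      (splitTensor he).tmul f (momentumPVM b' Y g) := by
  have ht : MeasurableSet {η : F | 2 * Real.pi * inner ℝ b' η ∈ Y} :=
    ((innerSL ℝ b').measurable.const_mul (2 * Real.pi)) hY
  have hset : {ξ : G | 2 * Real.pi * inner ℝ b ξ ∈ Y} =
      e ⁻¹' (Set.univ ×ˢ {η : F | 2 * Real.pi * inner ℝ b' η ∈ Y}) := by
    ext ξ
    simp [hb]
  rw [momentumPVM_apply, momentumPVM_apply, hset, fourier_splitTensor_tmul he hinner,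
    indicatorOp_splitTensor_tmul he .univ ht, indicatorOp_univ]
  refine (Lp.fourierTransformₗᵢ G ℂ).symm_apply_eq.2 ?_
  refine Eq.trans ?_ (fourier_splitTensor_tmul he hinner _ _).symm
  exact congrArg _ ((Lp.fourierTransformₗᵢ F ℂ).apply_symm_apply _).symm

theorem exists_diagonalize_position_momentum {a b : G} {a' : E} {b' : F}
    (ha : ∀ x, inner ℝ a x = inner ℝ a' (e x).1) (hb : ∀ x, inner ℝ b x = inner ℝ b' (e x).2) :
    ∃ V : L2 G ≃ₗᵢ[ℂ] L2 G, ∀ X Y : Set ℝ, MeasurableSet X → MeasurableSet Y → ∀ f : L2 G,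
      V (positionPVM a X (momentumPVM b Y f)) =
        indicatorOp {x | inner ℝ a x ∈ X ∧ 2 * Real.pi * inner ℝ b x ∈ Y} (V f) := by
  -- `V` is the Fourier transform in the second factor.
  obtain ⟨V, hV⟩ := (splitTensor he).exists_unitary
    ((splitTensor he).compRight (Lp.fourierTransformₗᵢ F ℂ))
  refine ⟨V, fun X Y hX hY f => ?_⟩
  have hs : MeasurableSet {y : E | inner ℝ a' y ∈ X} := (innerSL ℝ a').measurable hX
  have ht : MeasurableSet {η : F | 2 * Real.pi * inner ℝ b' η ∈ Y} :=
    ((innerSL ℝ b').measurable.const_mul (2 * Real.pi)) hY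
  have hset : {x | inner ℝ a x ∈ X ∧ 2 * Real.pi * inner ℝ b x ∈ Y} =
      e ⁻¹' ({y | inner ℝ a' y ∈ X} ×ˢ {η | 2 * Real.pi * inner ℝ b' η ∈ Y}) := by
    ext x
    simp [ha, hb]
  have key : (V.toContinuousLinearEquiv : L2 G →L[ℂ] L2 G) ∘L positionPVM a X ∘L momentumPVM b Y =
      indicatorOp {x | inner ℝ a x ∈ X ∧ 2 * Real.pi * inner ℝ b x ∈ Y} ∘L
        (V.toContinuousLinearEquiv : L2 G →L[ℂ] L2 G) := by
    refine (splitTensor he).ext_tmul fun g h => ?_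
    change V (positionPVM a X (momentumPVM b Y ((splitTensor he).tmul g h))) =
      indicatorOp _ (V ((splitTensor he).tmul g h))
    rw [momentumPVM_splitTensor_tmul he hinner hb hY, positionPVM_splitTensor_tmul he ha hX,
      hV, hV, HilbertTensor.compRight_tmul, HilbertTensor.compRight_tmul, hset,
      indicatorOp_splitTensor_tmul he hs ht]
    exact congrArg _ ((Lp.fourierTransformₗᵢ F ℂ).apply_symm_apply _)
  exact congrArg (fun A : L2 G →L[ℂ] L2 G => A f) key

end Splitting

/-! ### Positive operator valued measures -/

section ExpectationValues

variable {H : Type*} [NormedAddCommGroup H] [InnerProductSpace ℂ H]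

theorem ext_inner_unit {A B : H →L[ℂ] H}
    (h : ∀ ψ : H, ‖ψ‖ = 1 → inner ℂ ψ (A ψ) = inner ℂ ψ (B ψ)) : A = B := by
  refine ContinuousLinearMap.coe_injective ((ext_inner_map _ _).1 fun ψ => ?_)
  obtain rfl | hψ := eq_or_ne ψ 0
  · simp only [inner_zero_right]
  have hne : (‖ψ‖ : ℂ)⁻¹ ≠ 0 := inv_ne_zero (by exact_mod_cast norm_ne_zero_iff.2 hψ)
  have hunit : ‖(‖ψ‖ : ℂ)⁻¹ • ψ‖ = 1 := by
    rw [norm_smul, norm_inv, Complex.norm_real, norm_norm,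
      inv_mul_cancel₀ (norm_ne_zero_iff.2 hψ)]
  have hscaled := h _ hunit
  simp only [map_smul, inner_smul_left, inner_smul_right] at hscaled
  have heq : inner ℂ ψ (A ψ) = inner ℂ ψ (B ψ) :=
    mul_left_cancel₀ ((map_ne_zero _).2 hne) (mul_left_cancel₀ hne hscaled)
  change inner ℂ (A ψ) ψ = inner ℂ (B ψ) ψ
  rw [← inner_conj_symm, heq, inner_conj_symm]

end ExpectationValues

namespace POVM

variable {Ω : Type} [MeasurableSpace Ω] {H K : Type} [NormedAddCommGroup H]
  [InnerProductSpace ℂ H] [CompleteSpace H] [NormedAddCommGroup K] [InnerProductSpace ℂ K]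
  [CompleteSpace K]

theorem effect_empty (G : POVM Ω H) : G.effect ∅ = 0 := by
  ext1 ψ
  refine ext_inner_left ℂ fun φ => ?_
  have h := G.hasSum_iUnion (fun _ => ∅) (fun _ => MeasurableSet.empty)
    (fun _ _ _ => disjoint_bot_left) φ ψ
  rw [(summable_const_iff _).1 h.summable, zero_apply, inner_zero_right]

/-- The complex measure `Z ↦ ⟪φ, G(Z) ψ⟫` of matrix elements. -/
def toVectorMeasure (G : POVM Ω H) (φ ψ : H) : VectorMeasure Ω ℂ where
  measureOf' Z := inner ℂ φ (G.effect Z ψ)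
  empty' := by rw [effect_empty, zero_apply, inner_zero_right]
  not_measurable' Z hZ := by
    rw [G.effect_of_not_measurable Z hZ, zero_apply, inner_zero_right]
  m_iUnion' Z hZ hd := G.hasSum_iUnion Z hZ hd φ ψ

theorem toVectorMeasure_apply (G : POVM Ω H) (φ ψ : H) (Z : Set Ω) :
    G.toVectorMeasure φ ψ Z = inner ℂ φ (G.effect Z ψ) := rfl

theorem ext_effect {G G' : POVM Ω H} (h : ∀ Z, MeasurableSet Z → G.effect Z = G'.effect Z) :
    G = G' := by
  have heffect : G.effect = G'.effect := by
    funext Z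
    by_cases hZ : MeasurableSet Z
    · exact h Z hZ
    · rw [G.effect_of_not_measurable Z hZ, G'.effect_of_not_measurable Z hZ]
  cases G
  cases G'
  congr

theorem effect_add_effect_compl (G : POVM Ω H) {Z : Set Ω} (hZ : MeasurableSet Z) :
    G.effect Z + G.effect Zᶜ = 1 := by
  ext1 ψ
  refine ext_inner_left ℂ fun φ => ?_
  have h := VectorMeasure.of_add_of_sdiff (v := G.toVectorMeasure φ ψ) hZ .univ (Set.subset_univ Z)
  rw [← Set.compl_eq_univ_sdiff] at h
  simpa only [toVectorMeasure_apply, effect_univ, add_apply, inner_add_right] using h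

theorem norm_effect_le_one (G : POVM Ω H) (Z : Set Ω) : ‖G.effect Z‖ ≤ 1 := by
  by_cases hZ : MeasurableSet Z
  · have hpos := (ContinuousLinearMap.nonneg_iff_isPositive _).2 (G.isPositive Z hZ)
    have hcompl := (ContinuousLinearMap.nonneg_iff_isPositive _).2 (G.isPositive Zᶜ hZ.compl)
    rw [CStarAlgebra.norm_le_one_iff_of_nonneg _ hpos, ← G.effect_add_effect_compl hZ]
    exact le_add_of_nonneg_right hcompl
  · rw [G.effect_of_not_measurable Z hZ, norm_zero]
    exact zero_le_one

theorem norm_inner_effect_le (G : POVM Ω H) (Z : Set Ω) (φ ψ : H) :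
    ‖inner ℂ φ (G.effect Z ψ)‖ ≤ ‖φ‖ * ‖ψ‖ := by
  refine (norm_inner_le_norm _ _).trans ?_
  gcongr
  exact (G.effect Z).le_of_opNorm_le_of_le (G.norm_effect_le_one Z) le_rfl |>.trans_eq (one_mul _)

theorem norm_sum_inner_effect_le (G : POVM Ω H) {Z : ℕ → Set Ω} (hZ : ∀ n, MeasurableSet (Z n))
    (hd : Pairwise (Function.onFun Disjoint Z)) (s : Finset ℕ) (φ ψ : H) :
    ‖∑ n ∈ s, inner ℂ φ (G.effect (Z n) ψ)‖ ≤ ‖φ‖ * ‖ψ‖ := by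
  have h := (G.toVectorMeasure φ ψ).of_biUnion_finset (s := s) (f := Z)
    (fun i _ j _ hij => hd hij) (fun i _ => hZ i)
  simp only [toVectorMeasure_apply] at h
  rw [← h]
  exact G.norm_inner_effect_le _ φ ψ

/-! ### Compression by Kraus operators -/

section Compress

variable (P : POVM Ω K) {κ : Type} {A : κ → H →L[ℂ] K} (hA : Summable fun k => ‖A k‖ ^ 2)
include hA

theorem summable_adjoint_comp_effect_comp (Z : Set Ω) :
    Summable fun k => ContinuousLinearMap.adjoint (A k) ∘L P.effect Z ∘L A k := by
  refine Summable.of_norm_bounded hA fun k => ?_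
  calc _ ≤ ‖ContinuousLinearMap.adjoint (A k)‖ * (‖P.effect Z‖ * ‖A k‖) :=
        (ContinuousLinearMap.opNorm_comp_le _ _).trans
          (mul_le_mul_of_nonneg_left (ContinuousLinearMap.opNorm_comp_le _ _) (norm_nonneg _))
    _ ≤ ‖A k‖ * (1 * ‖A k‖) := by
        rw [LinearIsometryEquiv.norm_map]
        gcongr
        exact P.norm_effect_le_one Z
    _ = ‖A k‖ ^ 2 := by ring

theorem hasSum_inner_effect_comp (Z : Set Ω) (φ ψ : H) :
    HasSum (fun k => inner ℂ (A k φ) (P.effect Z (A k ψ)))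
      (inner ℂ φ ((∑' k, ContinuousLinearMap.adjoint (A k) ∘L P.effect Z ∘L A k) ψ)) := by
  have h := ((P.summable_adjoint_comp_effect_comp hA Z).hasSum.mapL
    (ContinuousLinearMap.apply ℂ H ψ)).mapL (innerSL ℂ φ)
  simpa [ContinuousLinearMap.adjoint_inner_right] using h

theorem hasSum_inner_tsum_iUnion {Z : ℕ → Set Ω} (hZ : ∀ n, MeasurableSet (Z n))
    (hd : Pairwise (Function.onFun Disjoint Z)) (φ ψ : H) :
    HasSum
      (fun n => inner ℂ φ ((∑' k, ContinuousLinearMap.adjoint (A k) ∘L P.effect (Z n) ∘L A k) ψ))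
      (inner ℂ φ
        ((∑' k, ContinuousLinearMap.adjoint (A k) ∘L P.effect (⋃ n, Z n) ∘L A k) ψ)) := by
  have hsum := fun Z => P.hasSum_inner_effect_comp hA Z φ ψ
  have hbound : ∀ (s : Finset ℕ) k,
      ‖∑ n ∈ s, inner ℂ (A k φ) (P.effect (Z n) (A k ψ))‖ ≤ ‖A k‖ ^ 2 * (‖φ‖ * ‖ψ‖) :=
    fun s k => calc
      _ ≤ ‖A k φ‖ * ‖A k ψ‖ := P.norm_sum_inner_effect_le hZ hd s _ _
      _ ≤ (‖A k‖ * ‖φ‖) * (‖A k‖ * ‖ψ‖) := by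
          gcongr <;> exact (A k).le_opNorm _
      _ = _ := by ring
  have hlim := tendsto_tsum_of_dominated_convergence (hA.mul_right (‖φ‖ * ‖ψ‖))
    (fun k => P.hasSum_iUnion Z hZ hd (A k φ) (A k ψ)) (Eventually.of_forall hbound)
  rw [(hsum _).tsum_eq] at hlim
  refine hlim.congr fun s => ?_
  rw [Summable.tsum_finsetSum fun n _ => (hsum (Z n)).summable]
  exact Finset.sum_congr rfl fun n _ => (hsum (Z n)).tsum_eq

/-- The observable `Z ↦ ∑ₖ Aₖ* P(Z) Aₖ` for Kraus operators `Aₖ`, that is, `∑ₖ Aₖ* Aₖ = 1`. -/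
def compress (h1 : ∀ φ ψ, HasSum (fun k => inner ℂ (A k φ) (A k ψ)) (inner ℂ φ ψ)) :
    POVM Ω H where
  effect Z := ∑' k, ContinuousLinearMap.adjoint (A k) ∘L P.effect Z ∘L A k
  effect_of_not_measurable Z hZ := by simp [P.effect_of_not_measurable Z hZ]
  isPositive Z hZ := by
    rw [← ContinuousLinearMap.nonneg_iff_isPositive]
    refine tsum_nonneg fun k => ?_
    rw [ContinuousLinearMap.nonneg_iff_isPositive]
    exact (P.isPositive Z hZ).adjoint_conj (A k)
  effect_univ := by
    ext1 ψ
    refine ext_inner_left ℂ fun φ => ?_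
    have h := P.hasSum_inner_effect_comp hA Set.univ φ ψ
    simp only [P.effect_univ, one_apply_eq_self] at h ⊢
    exact h.unique (h1 φ ψ)
  hasSum_iUnion _ hZ hd := P.hasSum_inner_tsum_iUnion hA hZ hd

theorem hasSum_inner_compress
    (h1 : ∀ φ ψ, HasSum (fun k => inner ℂ (A k φ) (A k ψ)) (inner ℂ φ ψ)) (Z : Set Ω) (φ ψ : H) :
    HasSum (fun k => inner ℂ (A k φ) (P.effect Z (A k ψ)))
      (inner ℂ φ ((P.compress hA h1).effect Z ψ)) :=
  P.hasSum_inner_effect_comp hA Z φ ψ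

end Compress

/-- The observable `Z ↦ V* P(Z) V` for an isometry `V`. -/
def comap (P : POVM Ω K) (V : H →ₗᵢ[ℂ] K) : POVM Ω H :=
  P.compress (A := fun _ : Unit => V.toContinuousLinearMap) (Summable.of_finite) fun φ ψ => by
    rw [← V.inner_map_map]
    exact hasSum_unique _

theorem inner_comap_effect (P : POVM Ω K) (V : H →ₗᵢ[ℂ] K) (Z : Set Ω) (φ ψ : H) :
    inner ℂ φ ((P.comap V).effect Z ψ) = inner ℂ (V φ) (P.effect Z (V ψ)) :=
  (P.hasSum_inner_compress _ _ Z φ ψ).unique (hasSum_unique _)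

theorem comp_effect_comp_adjoint_eq_of_prod {α β : Type} [MeasurableSpace α] [MeasurableSpace β]
    {G : POVM (α × β) H} {G' : POVM Ω K} {A : H →L[ℂ] K} {T : Ω → α × β} (hT : Measurable T)
    (h : ∀ X Y, MeasurableSet X → MeasurableSet Y →
      A ∘L G.effect (X ×ˢ Y) ∘L ContinuousLinearMap.adjoint A = G'.effect (T ⁻¹' (X ×ˢ Y)))
    {Z : Set (α × β)} (hZ : MeasurableSet Z) :
    A ∘L G.effect Z ∘L ContinuousLinearMap.adjoint A = G'.effect (T ⁻¹' Z) := by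
  ext1 ψ
  refine ext_inner_left ℂ fun φ => ?_
  let v := G.toVectorMeasure (ContinuousLinearMap.adjoint A φ) (ContinuousLinearMap.adjoint A ψ)
  let w := (G'.toVectorMeasure φ ψ).map T
  have hv : ∀ Z, v Z = inner ℂ φ ((A ∘L G.effect Z ∘L ContinuousLinearMap.adjoint A) ψ) :=
    fun Z => ContinuousLinearMap.adjoint_inner_left _ _ _
  have hw : ∀ {Z}, MeasurableSet Z → w Z = inner ℂ φ (G'.effect (T ⁻¹' Z) ψ) :=
    fun hZ => VectorMeasure.map_apply _ hT hZ
  have hprod : ∀ X Y, MeasurableSet X → MeasurableSet Y → v (X ×ˢ Y) = w (X ×ˢ Y) :=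
    fun X Y hX hY => by rw [hv, hw (hX.prod hY), h X Y hX hY]
  have hvw : v = w := by
    refine VectorMeasure.ext_of_generateFrom _ ?_ generateFrom_prod.symm isPiSystem_prod ?_
    · rintro _ ⟨X, hX, Y, hY, rfl⟩
      exact hprod X Y hX hY
    · rw [← Set.univ_prod_univ]
      exact hprod _ _ .univ .univ
  rw [← hv, hvw, hw hZ]

theorem ext_prod {α β : Type} [MeasurableSpace α] [MeasurableSpace β] {G G' : POVM (α × β) H}
    (h : ∀ X Y, MeasurableSet X → MeasurableSet Y → G.effect (X ×ˢ Y) = G'.effect (X ×ˢ Y)) :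
    G = G' := by
  refine ext_effect fun Z hZ => ?_
  have h1 := comp_effect_comp_adjoint_eq_of_prod (G := G) (G' := G')
    (A := ContinuousLinearMap.id ℂ H) measurable_id (fun X Y hX hY => by
      rw [ContinuousLinearMap.adjoint_id]
      exact h X Y hX hY) hZ
  rwa [ContinuousLinearMap.adjoint_id] at h1

end POVM

section Indicator

variable {E : Type} [NormedAddCommGroup E] [InnerProductSpace ℝ E] [MeasurableSpace E]
  [BorelSpace E] [FiniteDimensional ℝ E]

theorem inner_indicatorOp {s : Set E} (hs : MeasurableSet s) (f g : L2 E) :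
    inner ℂ f (indicatorOp s g) = ∫ x in s, inner ℂ (f x) (g x) := by
  rw [L2.inner_def, ← integral_indicator hs]
  refine integral_congr_ae ?_
  filter_upwards [coeFn_indicatorOp hs g] with x hx
  rw [hx]
  by_cases h : x ∈ s <;> simp [h]

theorem isPositive_indicatorOp {s : Set E} (hs : MeasurableSet s) :
    (indicatorOp s : L2 E →L[ℂ] L2 E).IsPositive := by
  have h : (indicatorOp s : L2 E →L[ℂ] L2 E) =
      ContinuousLinearMap.adjoint (indicatorOp s) ∘L indicatorOp s := by
    ext1 g
    refine ext_inner_left ℂ fun f => ?_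
    rw [ContinuousLinearMap.comp_apply, ContinuousLinearMap.adjoint_inner_right,
      inner_indicatorOp hs, inner_indicatorOp hs]
    refine setIntegral_congr_ae hs ?_
    filter_upwards [coeFn_indicatorOp hs f] with x hx hxs
    rw [hx, Set.indicator_of_mem hxs]
  rw [h]
  exact ContinuousLinearMap.isPositive_adjoint_comp_self _

/-- The observable of a measurable function of position. -/
def indicatorPOVM {Ω : Type} [MeasurableSpace Ω] {g : E → Ω} (hg : Measurable g) :
    POVM Ω (L2 E) where
  effect Z := open Classical in if MeasurableSet Z then indicatorOp (g ⁻¹' Z) else 0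
  effect_of_not_measurable Z hZ := if_neg hZ
  isPositive Z hZ := by
    rw [if_pos hZ]
    exact isPositive_indicatorOp (hg hZ)
  effect_univ := by
    rw [if_pos MeasurableSet.univ, Set.preimage_univ]
    exact ContinuousLinearMap.ext indicatorOp_univ
  hasSum_iUnion Z hZ hd φ ψ := by
    simp only [if_pos (hZ _), if_pos (MeasurableSet.iUnion hZ), Set.preimage_iUnion]
    rw [inner_indicatorOp (MeasurableSet.iUnion fun n => hg (hZ n))]
    simp only [inner_indicatorOp (hg (hZ _))]
    exact hasSum_integral_iUnion (fun n => hg (hZ n)) (fun i j hij => (hd hij).preimage g)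
      (L2.integrable_inner φ ψ).integrableOn

theorem indicatorPOVM_effect {Ω : Type} [MeasurableSpace Ω] {g : E → Ω} (hg : Measurable g)
    {Z : Set Ω} (hZ : MeasurableSet Z) : (indicatorPOVM hg).effect Z = indicatorOp (g ⁻¹' Z) :=
  if_pos hZ

end Indicator

/-! ### Traces -/

section Trace

variable {H K : Type} [NormedAddCommGroup H] [InnerProductSpace ℂ H]
  {ι κ : Type}

theorem hasSum_norm_inner_sq (e : HilbertBasis ι ℂ H) (v : H) :
    HasSum (fun i => ‖inner ℂ (e i) v‖ ^ 2) (‖v‖ ^ 2) := by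
  have h := e.hasSum_inner_mul_inner v v
  have hterm : ∀ i, inner ℂ v (e i) * inner ℂ (e i) v = ((‖inner ℂ (e i) v‖ ^ 2 : ℝ) : ℂ) := by
    intro i
    rw [← inner_conj_symm, RCLike.conj_mul]
    norm_cast
  rw [inner_self_eq_norm_sq_to_K] at h
  simp only [hterm] at h
  exact Complex.hasSum_ofReal.1 (by simpa using h)

theorem summable_norm_inner_sq (e : HilbertBasis ι ℂ H) {v : κ → H}
    (hv : Summable fun k => ‖v k‖ ^ 2) :
    Summable fun z : κ × ι => ‖inner ℂ (e z.2) (v z.1)‖ ^ 2 := by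
  rw [summable_prod_of_nonneg (fun _ => by positivity)]
  refine ⟨fun k => (hasSum_norm_inner_sq e (v k)).summable, ?_⟩
  simpa only [(hasSum_norm_inner_sq e _).tsum_eq] using hv

theorem summable_inner_mul_inner (e : HilbertBasis ι ℂ H) {v w : κ → H}
    (hv : Summable fun k => ‖v k‖ ^ 2) (hw : Summable fun k => ‖w k‖ ^ 2) :
    Summable fun z : κ × ι => inner ℂ (w z.1) (e z.2) * inner ℂ (e z.2) (v z.1) := by
  refine Summable.of_norm_bounded ((summable_norm_inner_sq e hw).add
    (summable_norm_inner_sq e hv)) fun z => ?_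
  rw [norm_mul, norm_inner_symm]
  nlinarith [two_mul_le_add_sq ‖inner ℂ (e z.2) (w z.1)‖ ‖inner ℂ (e z.2) (v z.1)‖,
    sq_nonneg ‖inner ℂ (e z.2) (w z.1)‖, sq_nonneg ‖inner ℂ (e z.2) (v z.1)‖]

variable [CompleteSpace H] [NormedAddCommGroup K] [InnerProductSpace ℂ K] [CompleteSpace K]

theorem HasTrace.unique {T : H →L[ℂ] H} {c c' : ℂ} (h : HasTrace T c) (h' : HasTrace T c') :
    c = c' := by
  obtain ⟨_, b, -⟩ := exists_hilbertBasis ℂ H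
  exact (h _ b).unique (h' _ b)

-- Both sides are iterated sums of the family `⟪M* A bₖ, eᵢ⟫ ⟪eᵢ, A bₖ⟫`, which is absolutely
-- summable because `A` is Hilbert–Schmidt.
theorem hasTrace_comp_adjoint_comp (A : K →L[ℂ] H) (M : H →L[ℂ] H) (b : HilbertBasis κ ℂ K)
    (hA : Summable fun k => ‖A (b k)‖ ^ 2) :
    HasTrace (A ∘L ContinuousLinearMap.adjoint A ∘L M)
      (∑' k, inner ℂ (A (b k)) (M (A (b k)))) := by
  intro ι e
  set M' := ContinuousLinearMap.adjoint M with hM'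
  set f : κ × ι → ℂ := fun z =>
    inner ℂ (M' (A (b z.1))) (e z.2) * inner ℂ (e z.2) (A (b z.1)) with hf_def
  have hMA : Summable fun k => ‖M' (A (b k))‖ ^ 2 := by
    refine (hA.mul_left (‖M'‖ ^ 2)).of_nonneg_of_le (fun _ => by positivity) fun k => ?_
    rw [← mul_pow]
    exact pow_le_pow_left₀ (norm_nonneg _) (M'.le_opNorm _) 2
  have hf : Summable f :=
    summable_inner_mul_inner e (v := fun k => A (b k)) (w := fun k => M' (A (b k))) hA hMA
  have hrow : ∀ k, HasSum (fun i => f (k, i)) (inner ℂ (A (b k)) (M (A (b k)))) := fun k => by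
    have h := e.hasSum_inner_mul_inner (M' (A (b k))) (A (b k))
    rwa [hM', ContinuousLinearMap.adjoint_inner_left] at h
  have hcol : ∀ i, HasSum (fun k => f (k, i))
      (inner ℂ (e i) ((A ∘L ContinuousLinearMap.adjoint A ∘L M) (e i))) := fun i => by
    have h := b.hasSum_inner_mul_inner (ContinuousLinearMap.adjoint A (e i))
      (ContinuousLinearMap.adjoint A (M (e i)))
    rw [ContinuousLinearMap.adjoint_inner_left] at h
    refine h.congr_fun fun k => ?_
    simp only [hf_def, hM']
    rw [ContinuousLinearMap.adjoint_inner_left, ContinuousLinearMap.adjoint_inner_right,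
      ContinuousLinearMap.adjoint_inner_left, mul_comm]
  rw [(hf.hasSum.prod_fiberwise hrow).tsum_eq]
  exact ((Equiv.prodComm ι κ).hasSum_iff.2 hf.hasSum).prod_fiberwise hcol

theorem IsDensityOperator.exists_sqrt {σ : H →L[ℂ] H} (hσ : IsDensityOperator σ) :
    ∃ S : H →L[ℂ] H, ContinuousLinearMap.adjoint S = S ∧ S ∘L S = σ ∧
      ∀ (ι : Type) (b : HilbertBasis ι ℂ H), HasSum (fun i => ‖S (b i)‖ ^ 2) 1 := by
  have h0 : 0 ≤ σ := (ContinuousLinearMap.nonneg_iff_isPositive σ).2 hσ.1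
  have hadj : ContinuousLinearMap.adjoint (CFC.sqrt σ) = CFC.sqrt σ :=
    ((ContinuousLinearMap.nonneg_iff_isPositive _).1
      (CFC.sqrt_nonneg σ)).isSelfAdjoint.adjoint_eq
  have hmul : CFC.sqrt σ ∘L CFC.sqrt σ = σ := CFC.sqrt_mul_sqrt_self σ h0
  have hterm : ∀ v, inner ℂ v (σ v) = ((‖CFC.sqrt σ v‖ ^ 2 : ℝ) : ℂ) := fun v => by
    conv_lhs => rw [← hmul]
    rw [ContinuousLinearMap.comp_apply, ← ContinuousLinearMap.adjoint_inner_left, hadj,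
      inner_self_eq_norm_sq_to_K]
    norm_cast
  refine ⟨CFC.sqrt σ, hadj, hmul, fun ι b => ?_⟩
  have h := hσ.2 ι b
  simp only [hterm] at h
  exact Complex.hasSum_ofReal.1 (by simpa using h)

end Trace

/-! ### The effective observable of the measurement -/

/-- The splitting `(q, q₁, q₂) ↦ ((q, q₁), q₂)`, which isolates the momentum pointer. -/
def splitLast : R3 ≃ᵐ R2 × ℝ :=
  ((MeasurableEquiv.toLp 2 (Fin 3 → ℝ)).symm.trans
    (MeasurableEquiv.piFinSuccAbove (fun _ : Fin 3 => ℝ) 2)).trans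
    (MeasurableEquiv.prodComm.trans
      (MeasurableEquiv.prodCongr (MeasurableEquiv.toLp 2 (Fin 2 → ℝ)) (MeasurableEquiv.refl ℝ)))

theorem splitLast_apply (x : R3) : splitLast x = (!₂[x 0, x 1], x 2) := by
  refine Prod.ext ?_ rfl
  ext i
  fin_cases i <;> rfl

theorem measurePreserving_splitLast :
    MeasurePreserving splitLast (volume : Measure R3) volume := by
  have hpi := volume_preserving_piFinSuccAbove (fun _ : Fin 3 => ℝ) 2
  have htoLp : MeasurePreserving (Prod.map (MeasurableEquiv.toLp 2 (Fin 2 → ℝ)) id)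
      (volume : Measure ((Fin 2 → ℝ) × ℝ)) (volume : Measure (R2 × ℝ)) :=
    (EuclideanSpace.volume_preserving_symm_measurableEquiv_toLp (Fin 2)).symm.prod
      (MeasurePreserving.id volume)
  exact htoLp.comp (Measure.measurePreserving_swap.comp
    (hpi.comp (EuclideanSpace.volume_preserving_symm_measurableEquiv_toLp (Fin 3))))

theorem exists_diagonalize_pointer :
    ∃ V : L2 R3 ≃ₗᵢ[ℂ] L2 R3, ∀ X Y : Set ℝ, MeasurableSet X → MeasurableSet Y → ∀ f : L2 R3,
      V (pointer X Y f) = indicatorOp {x | x 1 ∈ X ∧ 2 * Real.pi * x 2 ∈ Y} (V f) := by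
  have hinner : ∀ x y : R3, inner ℝ x y =
      inner ℝ (splitLast x).1 (splitLast y).1 + inner ℝ (splitLast x).2 (splitLast y).2 := by
    intro x y
    simp [splitLast_apply, PiLp.inner_apply, Fin.sum_univ_succ]
    ring
  obtain ⟨V, hV⟩ := exists_diagonalize_position_momentum (a := dir 1) (b := dir 2)
    (a' := EuclideanSpace.single 1 1) (b' := 1) measurePreserving_splitLast hinner
    (fun x => by simp [inner_dir, splitLast_apply, EuclideanSpace.inner_single_left])
    (fun x => by simp [inner_dir, splitLast_apply])
  refine ⟨V, fun X Y hX hY f => ?_⟩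
  have h := hV X Y hX hY f
  simp only [inner_dir] at h
  exact h

theorem image_mul_left_eq_preimage {a : ℝ} (ha : a ≠ 0) (X : Set ℝ) :
    (fun x => a * x) '' X = (fun x => x / a) ⁻¹' X :=
  congrFun (Set.image_eq_preimage_of_inverse (fun x => mul_div_cancel_left₀ x ha)
    (fun x => mul_div_cancel₀ x ha)) X

theorem exists_pointerPOVM {lam mu : ℝ} (hlam : lam ≠ 0) (hmu : mu ≠ 0) :
    ∃ P : POVM (ℝ × ℝ) (L2 R3), ∀ X Y : Set ℝ, MeasurableSet X → MeasurableSet Y →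
      P.effect (X ×ˢ Y) = pointer ((fun x => lam * x) '' X) ((fun y => mu * y) '' Y) := by
  obtain ⟨V, hV⟩ := exists_diagonalize_pointer
  have hdiv : ∀ a : ℝ, Measurable fun x : ℝ => x / a := fun a => measurable_id.div_const a
  have hg : Measurable fun x : R3 => (x 1 / lam, 2 * Real.pi * x 2 / mu) := by fun_prop
  refine ⟨(indicatorPOVM hg).comap V.toLinearIsometry, fun X Y hX hY => ?_⟩
  simp only [image_mul_left_eq_preimage hlam, image_mul_left_eq_preimage hmu]
  ext1 f
  refine ext_inner_left ℂ fun h => ?_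
  rw [POVM.inner_comap_effect, indicatorPOVM_effect hg (hX.prod hY), ← V.inner_map_map h,
    hV _ _ (hdiv lam hX) (hdiv mu hY)]
  rfl

/-- The bounded operator `ψ ↦ ψ ⊗ φ`. -/
def tensorR (φ : L2 R2) : L2 ℝ →L[ℂ] L2 R3 :=
  (Lp.compMeasurePreservingₗᵢ ℂ split measurePreserving_split).toContinuousLinearMap ∘L
    lpMulL.flip φ

theorem tensorR_apply (φ : L2 R2) (ψ : L2 ℝ) : tensorR φ ψ = tensor ψ φ :=
  Lp.toLp_compMeasurePreserving (memLp_two_mul_prod (Lp.memLp ψ) (Lp.memLp φ))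
    measurePreserving_split

/-- The Kraus operator `ψ ↦ U (ψ ⊗ φ)` of the measurement with the pure probe state `φ`. -/
def krausOp (lam mu κ : ℝ) (φ : L2 R2) : L2 ℝ →L[ℂ] L2 R3 := coupling lam mu κ ∘L tensorR φ

section Kraus

variable {lam mu κ : ℝ}

theorem krausOp_apply (φ : L2 R2) (ψ : L2 ℝ) :
    krausOp lam mu κ φ ψ = (couplingMap lam mu κ).op (tensor ψ φ) := by
  rw [krausOp, ContinuousLinearMap.comp_apply, tensorR_apply, coupling_apply]

theorem inner_krausOp (φ φ' : L2 R2) (ψ ψ' : L2 ℝ) :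
    inner ℂ (krausOp lam mu κ φ ψ) (krausOp lam mu κ φ' ψ') = inner ℂ ψ ψ' * inner ℂ φ φ' := by
  rw [krausOp_apply, krausOp_apply, LinearIsometry.inner_map_map, inner_tensor]

theorem norm_krausOp_apply (φ : L2 R2) (ψ : L2 ℝ) :
    ‖krausOp lam mu κ φ ψ‖ = ‖φ‖ * ‖ψ‖ := by
  rw [krausOp_apply, LinearIsometry.norm_map, norm_tensor, mul_comm]

variable {σ S : L2 R2 →L[ℂ] L2 R2} {ι : Type} (b : HilbertBasis ι ℂ (L2 R2))

theorem hasTrace_coupling (hadj : ContinuousLinearMap.adjoint S = S) (hS : S ∘L S = σ)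
    (hb : HasSum (fun i => ‖S (b i)‖ ^ 2) 1) (ψ : L2 ℝ) (M : L2 R3 →L[ℂ] L2 R3) :
    HasTrace (coupling lam mu κ ∘L pureTensor ψ σ ∘L
        ContinuousLinearMap.adjoint (coupling lam mu κ) ∘L M)
      (∑' i, inner ℂ (krausOp lam mu κ (S (b i)) ψ) (M (krausOp lam mu κ (S (b i)) ψ))) := by
  set A := coupling lam mu κ ∘L tensorL ψ ∘L S with hA
  have hA_apply : ∀ i, A (b i) = krausOp lam mu κ (S (b i)) ψ := fun i => by
    rw [krausOp, ContinuousLinearMap.comp_apply _ (tensorR _), tensorR_apply]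
    rfl
  have hfactor : coupling lam mu κ ∘L pureTensor ψ σ ∘L
      ContinuousLinearMap.adjoint (coupling lam mu κ) ∘L M =
        A ∘L ContinuousLinearMap.adjoint A ∘L M := by
    rw [hA, ContinuousLinearMap.adjoint_comp, ContinuousLinearMap.adjoint_comp, hadj, pureTensor,
      ← hS]
    rfl
  have hHS : Summable fun i => ‖A (b i)‖ ^ 2 := by
    simp only [hA_apply, norm_krausOp_apply, mul_pow]
    exact hb.summable.mul_right _
  have h := hasTrace_comp_adjoint_comp A M b hHS
  rw [hfactor]
  simpa only [hA_apply] using h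

theorem isEffectiveObservable_iff (hadj : ContinuousLinearMap.adjoint S = S) (hS : S ∘L S = σ)
    (hb : HasSum (fun i => ‖S (b i)‖ ^ 2) 1) {G : POVM (ℝ × ℝ) (L2 ℝ)} :
    IsEffectiveObservable lam mu κ σ G ↔
      ∀ X Y : Set ℝ, MeasurableSet X → MeasurableSet Y → ∀ ψ : L2 ℝ, ‖ψ‖ = 1 →
        inner ℂ ψ (G.effect (X ×ˢ Y) ψ) = ∑' i, inner ℂ (krausOp lam mu κ (S (b i)) ψ)
          (pointer ((fun x => lam * x) '' X) ((fun y => mu * y) '' Y)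
            (krausOp lam mu κ (S (b i)) ψ)) := by
  refine forall₅_congr fun X Y _ _ ψ => forall_congr' fun _ => ?_
  have h := hasTrace_coupling (lam := lam) (mu := mu) (κ := κ) b hadj hS hb ψ
    (pointer ((fun x => lam * x) '' X) ((fun y => mu * y) '' Y))
  exact ⟨fun h' => h'.unique h, fun h' => h' ▸ h⟩

theorem exists_isEffectiveObservable (hlam : lam ≠ 0) (hmu : mu ≠ 0) (hσ : IsDensityOperator σ) :
    ∃ G, IsEffectiveObservable lam mu κ σ G := by
  obtain ⟨S, hadj, hS, hS1⟩ := hσ.exists_sqrt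
  obtain ⟨_, b, -⟩ := exists_hilbertBasis ℂ (L2 R2)
  obtain ⟨P, hP⟩ := exists_pointerPOVM hlam hmu
  have hnorm : ∀ i, ‖krausOp lam mu κ (S (b i))‖ ≤ ‖S (b i)‖ := fun i =>
    ContinuousLinearMap.opNorm_le_bound _ (norm_nonneg _) fun ψ => (norm_krausOp_apply _ ψ).le
  have hsummable : Summable fun i => ‖krausOp lam mu κ (S (b i))‖ ^ 2 :=
    (hS1 _ b).summable.of_nonneg_of_le (fun _ => by positivity)
      fun i => pow_le_pow_left₀ (norm_nonneg _) (hnorm i) 2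
  have hone : ∀ φ ψ : L2 ℝ, HasSum
      (fun i => inner ℂ (krausOp lam mu κ (S (b i)) φ) (krausOp lam mu κ (S (b i)) ψ))
      (inner ℂ φ ψ) := fun φ ψ => by
    simp only [inner_krausOp, inner_self_eq_norm_sq_to_K]
    simpa using (Complex.hasSum_ofReal.2 (hS1 _ b)).mul_left (inner ℂ φ ψ)
  refine ⟨P.compress hsummable hone,
    (isEffectiveObservable_iff b hadj hS (hS1 _ b)).2 fun X Y hX hY ψ _ => ?_⟩
  rw [← hP X Y hX hY]
  exact (P.hasSum_inner_compress hsummable hone _ ψ ψ).tsum_eq.symm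

theorem IsEffectiveObservable.unique {G G' : POVM (ℝ × ℝ) (L2 ℝ)}
    (hG : IsEffectiveObservable lam mu κ σ G) (hG' : IsEffectiveObservable lam mu κ σ G') :
    G = G' :=
  POVM.ext_prod fun X Y hX hY =>
    ext_inner_unit fun ψ hψ => (hG X Y hX hY ψ hψ).unique (hG' X Y hX hY ψ hψ)

end Kraus

/-! ### Covariance -/

theorem PhaseMap.op_displacement_op {E : Type} [NormedAddCommGroup E] [InnerProductSpace ℝ E]
    [MeasurableSpace E] [BorelSpace E] [FiniteDimensional ℝ E] (c : PhaseMap (volume : Measure E))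
    {v v' w w' : E} (hv : ∀ x, c.map (x + v') = c.map x + v)
    (hw : ∀ x, inner ℝ w (c.map x) = inner ℝ w' x) (hc : ∀ x, c.phase (x + v') = c.phase x)
    (θ : ℝ) (f : L2 E) :
    c.op ((displacement θ v w).op f) = (displacement θ v' w').op (c.op f) := by
  rw [← op_comp, ← op_comp]
  congr 2
  ext x
  · simp only [comp, displacement, hw, hc, mul_comm]
  · simp only [comp, displacement, Function.comp_apply, hv]

theorem tensor_displacement_op (θ v w : ℝ) (ψ : L2 ℝ) (φ : L2 R2) :
    tensor ((displacement θ v w).op ψ) φ =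
      (displacement θ (v • dir 0) (w • dir 0)).op (tensor ψ φ) := by
  have hq := Measure.quasiMeasurePreserving_fst.comp
    measurePreserving_split.quasiMeasurePreserving
  ext1
  filter_upwards [(memLp_tensor ((displacement θ v w).op ψ) φ).coeFn_toLp,
    hq.ae ((displacement θ v w).coeFn_op ψ),
    (displacement θ (v • dir 0) (w • dir 0)).coeFn_op (tensor ψ φ),
    (displacement θ (v • dir 0) (w • dir 0)).ae_comp (memLp_tensor ψ φ).coeFn_toLp]
    with x h1 h2 h3 h4
  have hsplit : split (x + v • dir 0) = (x 0 + v, (split x).2) := by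
    simp [split, dir]
  have hinner : inner ℝ (w • dir 0) x = inner ℝ w (x 0) := by
    rw [real_inner_smul_left, inner_dir]
    simp [mul_comm]
  rw [tensor, h1, h3, tensor, h4]
  simp only [Function.comp_apply] at h2
  rw [h2]
  simp only [displacement, hsplit, hinner, mul_assoc]
  rfl

/-- The phase space displacement of system and probes into which the coupling turns the
translation `W_{qp}*` of the system. -/
def pointerShift (lam mu q p : ℝ) : PhaseMap (volume : Measure R3) :=
  displacement (-(q * p) / 2) (q • dir 0 + (lam * q) • dir 1) (-p • (dir 0 + mu • dir 2))

theorem krausOp_adjoint_weyl (lam mu κ q p : ℝ) (φ : L2 R2) (ψ : L2 ℝ) :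
    krausOp lam mu κ φ (ContinuousLinearMap.adjoint (weyl q p) ψ) =
      (pointerShift lam mu q p).op (krausOp lam mu κ φ ψ) := by
  rw [krausOp_apply, krausOp_apply, adjoint_weyl_apply, tensor_displacement_op, pointerShift]
  refine (couplingMap lam mu κ).op_displacement_op (fun x => ?_) (fun x => ?_) (fun _ => rfl) _ _
  · rw [couplingMap_map, couplingMap_map]
    ext i
    fin_cases i <;> simp [dir] <;> ring
  · rw [couplingMap_map]
    simp only [inner_smul_left, inner_add_left, inner_dir]
    simp [dir]

theorem pointer_displacement_op (θ : ℝ) (v w : R3) {X Y : Set ℝ} (hX : MeasurableSet X)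
    (hY : MeasurableSet Y) (f : L2 R3) :
    pointer ((· + v 1) ⁻¹' X) ((· - w 2) ⁻¹' Y) ((displacement θ v w).op f) =
      (displacement θ v w).op (pointer X Y f) := by
  have hposition := positionPVM_displacement_op θ v w (dir 1) hX
  have hmomentum := momentumPVM_displacement_op θ v w (dir 2) hY
  simp only [inner_dir] at hposition hmomentum
  rw [pointer, pointer, ContinuousLinearMap.comp_apply, ContinuousLinearMap.comp_apply,
    hmomentum, hposition]

theorem pointer_pointerShift_op {lam mu : ℝ} (hlam : lam ≠ 0) (hmu : mu ≠ 0) (q p : ℝ)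
    {X Y : Set ℝ} (hX : MeasurableSet X) (hY : MeasurableSet Y) (f : L2 R3) :
    pointer ((fun x => lam * x) '' X) ((fun y => mu * y) '' Y) ((pointerShift lam mu q p).op f) =
      (pointerShift lam mu q p).op (pointer ((fun x => lam * x) '' ((· - q) ⁻¹' X))
        ((fun y => mu * y) '' ((· - p) ⁻¹' Y)) f) := by
  simp only [image_mul_left_eq_preimage hlam, image_mul_left_eq_preimage hmu]
  have hX' : MeasurableSet ((fun x => x / lam) ⁻¹' ((· - q) ⁻¹' X)) :=
    (hX.preimage (measurable_id.sub_const q)).preimage (measurable_id.div_const lam)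
  have hY' : MeasurableSet ((fun y => y / mu) ⁻¹' ((· - p) ⁻¹' Y)) :=
    (hY.preimage (measurable_id.sub_const p)).preimage (measurable_id.div_const mu)
  rw [pointerShift, ← pointer_displacement_op _ _ _ hX' hY']
  congr 2
  · ext x
    simp [dir, add_div, hlam]
  · ext y
    simp [dir, add_div, hmu]

theorem IsEffectiveObservable.isCovariant {lam mu κ : ℝ} (hlam : lam ≠ 0) (hmu : mu ≠ 0)
    {σ : L2 R2 →L[ℂ] L2 R2} (hσ : IsDensityOperator σ) {G : POVM (ℝ × ℝ) (L2 ℝ)}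
    (hG : IsEffectiveObservable lam mu κ σ G) : IsCovariant G := by
  obtain ⟨S, hadj, hS, hS1⟩ := hσ.exists_sqrt
  obtain ⟨_, b, -⟩ := exists_hilbertBasis ℂ (L2 R2)
  have hprob := (isEffectiveObservable_iff b hadj hS (hS1 _ b)).1 hG
  have hsub : ∀ a : ℝ, Measurable fun x : ℝ => x - a := fun a => measurable_id.sub_const a
  intro q p Z hZ
  have himage : (fun z => z + (q, p)) '' Z = (fun z => z - (q, p)) ⁻¹' Z := by
    simp [sub_eq_add_neg]
  rw [himage]
  refine POVM.comp_effect_comp_adjoint_eq_of_prod (by fun_prop) (fun X Y hX hY => ?_) hZ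
  refine ext_inner_unit fun ψ hψ => ?_
  have hψ' : ‖ContinuousLinearMap.adjoint (weyl q p) ψ‖ = 1 := by
    rw [adjoint_weyl_apply, LinearIsometry.norm_map, hψ]
  have hset : (fun z : ℝ × ℝ => z - (q, p)) ⁻¹' (X ×ˢ Y) = ((· - q) ⁻¹' X) ×ˢ ((· - p) ⁻¹' Y) :=
    rfl
  rw [hset, ContinuousLinearMap.comp_apply, ContinuousLinearMap.comp_apply,
    ← ContinuousLinearMap.adjoint_inner_left, hprob X Y hX hY _ hψ',
    hprob _ _ (hsub q hX) (hsub p hY) ψ hψ]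
  refine tsum_congr fun i => ?_
  rw [krausOp_adjoint_weyl, pointer_pointerShift_op hlam hmu q p hX hY,
    LinearIsometry.inner_map_map]

end ArthursKelly

end

theorem theorem1_general (lam mu κ : ℝ) (hlam : lam ≠ 0) (hmu : mu ≠ 0)
    (σ : ArthursKelly.L2 ArthursKelly.R2 →L[ℂ] ArthursKelly.L2 ArthursKelly.R2)
    (hσ : ArthursKelly.IsDensityOperator σ) :
    (∃! G, ArthursKelly.IsEffectiveObservable lam mu κ σ G) ∧
      ∀ G, ArthursKelly.IsEffectiveObservable lam mu κ σ G → ArthursKelly.IsCovariant G := by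
  obtain ⟨G, hG⟩ := ArthursKelly.exists_isEffectiveObservable (κ := κ) hlam hmu hσ
  exact ⟨⟨G, hG, fun G' hG' => hG'.unique hG⟩, fun G hG => hG.isCovariant hlam hmu hσ⟩

theorem theorem1 (lam mu κ : ℝ) (hlam : 0 < lam) (hmu : 0 < mu)
    (σ : ArthursKelly.L2 ArthursKelly.R2 →L[ℂ] ArthursKelly.L2 ArthursKelly.R2)
    (hσ : ArthursKelly.IsDensityOperator σ) :
    (∃! G, ArthursKelly.IsEffectiveObservable lam mu κ σ G) ∧
      ∀ G, ArthursKelly.IsEffectiveObservable lam mu κ σ G → ArthursKelly.IsCovariant G :=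
  theorem1_general lam mu κ hlam.ne' hmu.ne' σ hσ
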